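/- Let $\mathbb D$ be an infinite set (of constants) and $*\notin\mathbb D$. An *extended star-tuple* of arity $n$ is $\dot t=(\dot t(1),\dots,\dot t(n),\dot t(n+1))$ with $\dot t(i)\in\mathbb D\cup\{*\}$ for $i\le n$ and $\dot t(n+1)$ a finite set of literals of the forms $i=j$, $i\ne j$, $i\ne a$ ($i,j\le n$, $a\in\mathbb D$; $i=j$ and $j=i$ are identified, likewise $i\neq j$ and $j\neq i$). It represents all $v\in\mathbb D^n$ with $v(i)=\dot t(i)$ whenever $\dot t(i)\neq *$ that satisfy all literals of $\dot t(n+1)$ (with $i$ read as $v(i)$). An *extended star-cylinder* is a finite set of extended star-tuples. The *normal form* of a tuple that represents at least one $v$ has entry $a$ in every column that is forced to be $a$, entry $*$ elsewhere, and as condition all implied literals $i=j$, $i\ne j$ ($i\neq j$ as indices) and $i\neq a$ ($a$ occurring in the tuple) that mention only $*$-columns. The *meet* $\dot t\curlywedge\dot u$ is undefined if $\dot t,\dot u$ have different constants in some column; otherwise it is the normal form of the tuple that has the constant of $\dot t$ or $\dot u$ where there is one, $*$ elsewhere, and condition $\dot t(n+1)\cup\dot u(n+1)$, and is undefined if that tuple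 represents nothing. For a sequence $\dot{\mathbf C}=(\dot C_1,\dots,\dot C_m)$ with set of constants $A$, the *sieve* $\dot A$ is the set of all satisfiable tuples with entries in $A\cup\{*\}$ whose condition consists of $i\ne a$ for every $*$-column $i$ and $a\in A$, and exactly one of $i=j$, $i\neq j$ for every pair of different $*$-columns. $\mathrm{SCA}_n$-expressions are built from the atoms $\dot{\mathsf C}_p$ ($p\le m$), with value $\dot C_p$, and $\dot{\mathsf d}_{ij}$, with value $\{(*,\dots,*,\{i=j\})\}$, by the operators: * union; intersection $\dot C\mathbin{\dot\cap}\dot D$, the set of all defined meets $\dot t\curlywedge\dot u$, $\dot t\in\dot C$, $\dot u\in\dot D$; * outer cylindrification $\dot{\mathsf c}_i$, which in each tuple sets column $i$ to $*$ and deletes all literals mentioning $i$; * complement $\{\dot t\in\dot A:\{\dot t\}\mathbin{\dot\cap}\dot C=\emptyset\}$; * inner cylindrification $\{\dot t\in\dot C\mathbin{\dot\cap}\dot A:\ \dot{\mathsf c}_i(\{\dot t\})\mathbin{\dot\cap}\dot A\preceq\dot C\mathbin{\dot\cap}\dot A\}$. Here $\dot C\preceq\dot D$ means that each $\dot t\in\dot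 C$ is dominated by some $\dot u\in\dot D$: for each $i\le n$, $\dot u(i)=*$ or $\dot u(i)=\dot t(i)$, and every literal of $\dot u(n+1)$, after replacing each column of it that has a constant in $\dot t$ by this constant, is true or belongs to $\dot t(n+1)$ — where, for $i=j$, if exactly one of $\dot t(i),\dot t(j)$ is $*$, it counts as not true. A *naive star-cylinder* is a finite set of star-tuples over $\mathbb D\cup\{\bot_1,\bot_2,\dots\}$ (the $\bot_k$ are existential nulls, treated as further constants) whose conditions contain only equalities. An expression without complement (*negation-free*) is evaluated on naive star-cylinders by the same operators, except that inner cylindrification is $\{\dot t\in\dot C:\dot t(i)=*\text{ and }(i=j)\notin\dot t(n+1)\text{ for all }j\ne i\}$. Let $|\dot{\mathbf C}|$ be the larger of the number of star-tuples in $\dot{\mathbf C}$ and the largest number of literals in the condition of a star-tuple of $\dot{\mathbf C}$, and similarly for a single star-cylinder. Computations are by while-programs on binary trees (cons cells with leaves $\mathrm{nil}$ or an element of the domain), where each elementary operation ($\mathrm{nil}$, variable access, cons, head, tail, equality test of two domain elements), each assignment, sequencing, branching and loop test costs one step. A star-cylinder is represented by a list, in any order and without repetition, of its tuples, each given by the list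 of its $n$ entries and a list, in any order and without repetition, of its literals. **Theorem.** Let $\dot E$ be a fixed $\mathrm{SCA}_n$-expression over $m$ star-cylinders. There is a polynomial $\pi$ such that: 1. $|\dot E(\dot{\mathbf C})|\le\pi(|\dot{\mathbf C}|)$ for every sequence $\dot{\mathbf C}$ of $m$ extended $n$-dimensional star-cylinders, and there is a program that computes $\dot E(\dot{\mathbf C})$ from every representation of every such $\dot{\mathbf C}$ in at most $\pi(|\dot{\mathbf C}|)$ steps. 2. If $\dot E$ is negation-free, then likewise $|\dot E(\ddot{\mathbf C})|\le\pi(|\ddot{\mathbf C}|)$ for every sequence $\ddot{\mathbf C}$ of $m$ naive $n$-dimensional star-cylinders, and there is a program that computes $\dot E(\ddot{\mathbf C})$ from every representation of every such $\ddot{\mathbf C}$ in at most $\pi(|\ddot{\mathbf C}|)$ steps. -/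

import Mathlib

noncomputable section

open scoped Classical

namespace SCA

/-! ### Star-tuples and star-cylinders over a domain `D` -/

/-- Literals on the columns of an `n`-ary star-tuple: `i = j`, `i ≠ j` and `i ≠ a`. The first two
carry the unordered pair of columns, so that `i = j` and `j = i` are one literal. -/
inductive Lit (n : ℕ) (D : Type*) where
  | eq (p : Sym2 (Fin n))
  | ne (p : Sym2 (Fin n))
  | neConst (i : Fin n) (a : D)

/-- The columns that a literal mentions. -/
def Lit.Mentions {n : ℕ} {D : Type*} : Lit n D → Fin n → Prop
  | .eq p, i => i ∈ p
  | .ne p, i => i ∈ p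
  | .neConst j _, i => i = j

/-- The constants that occur in a literal. -/
def Lit.consts {n : ℕ} {D : Type*} : Lit n D → Finset D
  | .eq _ => ∅
  | .ne _ => ∅
  | .neConst _ a => {a}

/-- An ordinary tuple `v` satisfies a literal. -/
def Lit.Holds {n : ℕ} {D : Type*} (v : Fin n → D) : Lit n D → Prop
  | .eq p => (p.map v).IsDiag
  | .ne p => ¬ (p.map v).IsDiag
  | .neConst i a => v i ≠ a

/-- The literals with constants in `A`, except for the trivial `i = i` and `i ≠ i`. -/
def litsOver (n : ℕ) {D : Type*} (A : Finset D) : Finset (Lit n D) :=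
  ((Finset.univ.filter fun p : Sym2 (Fin n) => ¬ p.IsDiag).image Lit.eq) ∪
  ((Finset.univ.filter fun p : Sym2 (Fin n) => ¬ p.IsDiag).image Lit.ne) ∪
  ((Finset.univ ×ˢ A).image fun q : Fin n × D => Lit.neConst q.1 q.2)

/-- Extended star-tuples: `n` entries, `none` standing for `*`, and in column `n + 1` a finite set
of literals (a conjunction; the empty set is `true`). -/
structure StarTuple (n : ℕ) (D : Type*) where
  val : Fin n → Option D
  cond : Finset (Lit n D)

/-- Extended star-cylinders: finite sets of extended star-tuples. -/
abbrev StarCyl (n : ℕ) (D : Type*) := Finset (StarTuple n D)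

section

variable {n m : ℕ} {D : Type*}

/-- The constants that occur in a star-tuple. -/
def StarTuple.consts (t : StarTuple n D) : Finset D :=
  (Finset.univ.biUnion fun i => (t.val i).toFinset) ∪ t.cond.biUnion Lit.consts

/-- The ordinary tuple `v` is one of those represented by `t`. -/
def StarTuple.Holds (t : StarTuple n D) (v : Fin n → D) : Prop :=
  (∀ i a, t.val i = some a → v i = a) ∧ ∀ l ∈ t.cond, l.Holds v

/-- The set of ordinary tuples that a star-cylinder represents. -/
def denote (C : StarCyl n D) : Set (Fin n → D) := {v | ∃ t ∈ C, t.Holds v}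

def StarTuple.Satisfiable (t : StarTuple n D) : Prop := ∃ v, t.Holds v

/-- Logical implication of a literal by the entries and the condition of `t`. -/
def StarTuple.Entails (t : StarTuple n D) (l : Lit n D) : Prop := ∀ v, t.Holds v → l.Holds v

/-- The entries of the normal form: `a` in the columns in which `t` forces the value `a`, and `*`
elsewhere. -/
def StarTuple.forced (t : StarTuple n D) (i : Fin n) : Option D :=
  if h : ∃ a, ∀ v, t.Holds v → v i = a then some h.choose else none

/-- The normal form of a star-tuple. An unsatisfiable tuple has none: the value `none` plays the
part of the tuple `t_∅` with condition `false`. Otherwise the forced entries are filled in and the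
condition is the logically closed set of all literals on the `*`-columns that `t` implies. -/
def StarTuple.normalize (t : StarTuple n D) : Option (StarTuple n D) :=
  if t.Satisfiable then
    some
      { val := t.forced
        cond := (litsOver n t.consts).filter fun l =>
          t.Entails l ∧ ∀ i, l.Mentions i → t.forced i = none }
  else none

/-- The meet of two star-tuples, in normal form; `none` is `t_∅`. -/
def StarTuple.meet (t u : StarTuple n D) : Option (StarTuple n D) :=
  if ∃ j a b, t.val j = some a ∧ u.val j = some b ∧ a ≠ b then none
  else StarTuple.normalize { val := fun i => (t.val i).or (u.val i), cond := t.cond ∪ u.cond }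

/-- What it takes for the tuple `t` to meet the condition `l` of a dominating tuple. -/
def StarTuple.Forces (t : StarTuple n D) : Lit n D → Prop
  | .eq p => ∀ i j, p = s(i, j) →
      if t.val i = none ∧ t.val j = none then i = j ∨ Lit.eq s(i, j) ∈ t.cond
      else t.val i = t.val j
  | .ne p => ∀ i j, p = s(i, j) →
      match t.val i, t.val j with
      | none, none => Lit.ne s(i, j) ∈ t.cond
      | some a, none => Lit.neConst j a ∈ t.cond
      | none, some b => Lit.neConst i b ∈ t.cond
      | some a, some b => a ≠ b
  | .neConst i a =>
      match t.val i with
      | none => Lit.neConst i a ∈ t.cond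
      | some b => b ≠ a

/-- The tuple `u` dominates `t`. -/
def StarTuple.Dominated (t u : StarTuple n D) : Prop :=
  (∀ i, u.val i = none ∨ t.val i = u.val i) ∧ ∀ l ∈ u.cond, t.Forces l

/-- The star-cylinder `C'` dominates `C`. -/
def Dominated (C C' : StarCyl n D) : Prop := ∀ t ∈ C, ∃ u ∈ C', t.Dominated u

/-! ### The operators of the star algebra -/

/-- The star-diagonal. -/
def diagonal (i j : Fin n) : StarCyl n D := {{ val := fun _ => none, cond := {Lit.eq s(i, j)} }}

/-- Star-intersection: all meets different from `t_∅`. -/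
def inter (C C' : StarCyl n D) : StarCyl n D :=
  (C ×ˢ C').biUnion fun q => (q.1.meet q.2).toFinset

/-- Outer cylindrification of a star-tuple on column `i`. -/
def StarTuple.outer (i : Fin n) (t : StarTuple n D) : StarTuple n D where
  val := Function.update t.val i none
  cond := t.cond.filter fun l => ¬ l.Mentions i

/-- Outer cylindrification of a star-cylinder on column `i`. -/
def outer (i : Fin n) (C : StarCyl n D) : StarCyl n D := C.image (StarTuple.outer i)

/-- Inner cylindrification of the positive algebra. -/
def innerPos (i : Fin n) (C : StarCyl n D) : StarCyl n D :=
  C.filter fun t => t.val i = none ∧ ∀ j, j ≠ i → Lit.eq s(i, j) ∉ t.cond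

/-- The pairs of different `*`-columns of `t`. -/
def starPairs (t : Fin n → Option D) : Finset (Sym2 (Fin n)) :=
  Finset.univ.filter fun p => ¬ p.IsDiag ∧ ∀ i ∈ p, t i = none

/-- The tuple of the sieve with entries `t`, in which the pairs in `S` are equated and all other
pairs of `*`-columns are kept apart. -/
def sieveTuple (A : Finset D) (t : Fin n → Option D) (S : Finset (Sym2 (Fin n))) :
    StarTuple n D where
  val := t
  cond :=
    (((Finset.univ.filter fun i => t i = none) ×ˢ A).image fun q => Lit.neConst q.1 q.2) ∪
    S.image Lit.eq ∪ (starPairs t \ S).image Lit.ne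

/-- The sieve for the finite set `A` of constants (its satisfiable tuples). -/
def sieve (n : ℕ) (A : Finset D) : StarCyl n D :=
  ((Fintype.piFinset fun _ : Fin n => Finset.insertNone A).biUnion fun t =>
    (starPairs t).powerset.image (sieveTuple A t)).filter StarTuple.Satisfiable

/-- Complement relative to the sieve: the sieve tuples all of whose meets with `C` are `t_∅`. -/
def compl (A : Finset D) (C : StarCyl n D) : StarCyl n D :=
  (sieve n A).filter fun t => inter {t} C = ∅

/-- Inner cylindrification of the algebra with negation. -/
def inner (A : Finset D) (i : Fin n) (C : StarCyl n D) : StarCyl n D :=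
  (inter C (sieve n A)).filter fun t =>
    Dominated (inter (outer i {t}) (sieve n A)) (inter C (sieve n A))

/-! ### Expressions and their values -/

/-- `SCA_n`-expressions over `m` star-cylinders and the diagonals. -/
inductive Expr (n m : ℕ) where
  | cyl (p : Fin m)
  | diag (i j : Fin n)
  | union (E F : Expr n m)
  | inter (E F : Expr n m)
  | outer (i : Fin n) (E : Expr n m)
  | inner (i : Fin n) (E : Expr n m)
  | compl (E : Expr n m)

/-- Negation is not used in the expression, i.e. it is an `SCA⁺_n`-expression. -/
def Expr.NegFree : Expr n m → Prop
  | .cyl _ => True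
  | .diag _ _ => True
  | .union E F => E.NegFree ∧ F.NegFree
  | .inter E F => E.NegFree ∧ F.NegFree
  | .outer _ E => E.NegFree
  | .inner _ E => E.NegFree
  | .compl _ => False

/-- The constants that occur in a sequence of star-cylinders. -/
def seqConsts (C : Fin m → StarCyl n D) : Finset D :=
  Finset.univ.biUnion fun p => (C p).biUnion StarTuple.consts

/-- The value of an expression on a sequence of extended star-cylinders. -/
def eval (C : Fin m → StarCyl n D) : Expr n m → StarCyl n D
  | .cyl p => C p
  | .diag i j => diagonal i j
  | .union E F => eval C E ∪ eval C F
  | .inter E F => SCA.inter (eval C E) (eval C F)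
  | .outer i E => SCA.outer i (eval C E)
  | .inner i E => SCA.inner (seqConsts C) i (eval C E)
  | .compl E => SCA.compl (seqConsts C) (eval C E)

/-- The value of a negation-free expression in the positive star algebra. -/
def evalPos (C : Fin m → StarCyl n D) : (E : Expr n m) → E.NegFree → StarCyl n D
  | .cyl p, _ => C p
  | .diag i j, _ => diagonal i j
  | .union E F, h => evalPos C E h.1 ∪ evalPos C F h.2
  | .inter E F, h => SCA.inter (evalPos C E h.1) (evalPos C F h.2)
  | .outer i E, h => SCA.outer i (evalPos C E h)
  | .inner i E, h => innerPos i (evalPos C E h)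
  | .compl _, h => h.elim

/-- All conditions are sets of equalities. -/
def IsPositive (C : StarCyl n D) : Prop := ∀ t ∈ C, ∀ l ∈ t.cond, ∃ p, l = Lit.eq p

/-- Entries of naive star-cylinders other than `*`: constants in `D` and countably many existential
nulls. A naive star-cylinder is a positive star-cylinder over `Naive D`. -/
abbrev Naive (D : Type*) := D ⊕ ℕ

/-! ### Size -/

/-- The larger of the number of star-tuples and the largest number of literals in a condition. -/
def size (C : StarCyl n D) : ℕ := max C.card (C.sup fun t => t.cond.card)

/-- The same for a sequence of star-cylinders. -/
def seqSize (C : Fin m → StarCyl n D) : ℕ :=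
  max (∑ p, (C p).card) (Finset.univ.sup fun p => (C p).sup fun t => t.cond.card)

end

/-! ### Machine model

While-programs over binary trees (cons cells) whose leaves are `nil` or atoms, an atom being an
element of the domain. Atoms can only be copied and tested for equality, each at unit cost. Every
node of an expression that is evaluated and every command executed costs one step; each step is
a constant number of pointer operations. -/

/-- The values stored in variables. -/
inductive Val (D : Type*) where
  | nil
  | atom (a : D)
  | cons (x y : Val D)

def Val.hd {D : Type*} : Val D → Val D
  | .cons x _ => x
  | _ => .nil

def Val.tl {D : Type*} : Val D → Val D
  | .cons _ y => y
  | _ => .nil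

/-- Equality test for atoms: true (non-`nil`) exactly when both values are the same atom. -/
def Val.atomEq {D : Type*} : Val D → Val D → Val D
  | .atom a, .atom b => if a = b then .cons .nil .nil else .nil
  | _, _ => .nil

/-- Program expressions; variables are numbered. -/
inductive PExp where
  | var (x : ℕ)
  | nil
  | cons (e f : PExp)
  | hd (e : PExp)
  | tl (e : PExp)
  | atomEq (e f : PExp)

def PExp.eval {D : Type*} (s : ℕ → Val D) : PExp → Val D
  | .var x => s x
  | .nil => .nil
  | .cons e f => .cons (e.eval s) (f.eval s)
  | .hd e => (e.eval s).hd
  | .tl e => (e.eval s).tl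
  | .atomEq e f => (e.eval s).atomEq (f.eval s)

/-- The number of steps for evaluating an expression. -/
def PExp.cost : PExp → ℕ
  | .var _ => 1
  | .nil => 1
  | .cons e f => e.cost + f.cost + 1
  | .hd e => e.cost + 1
  | .tl e => e.cost + 1
  | .atomEq e f => e.cost + f.cost + 1

/-- Programs. A test succeeds when its value is not `nil`. -/
inductive Prog where
  | assign (x : ℕ) (e : PExp)
  | seq (P Q : Prog)
  | ite (e : PExp) (P Q : Prog)
  | loop (e : PExp) (P : Prog)

/-- `Run P s k s'`: the program `P`, started in the store `s`, halts after `k` steps in the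
store `s'`. -/
inductive Run {D : Type*} : Prog → (ℕ → Val D) → ℕ → (ℕ → Val D) → Prop where
  | assign (s : ℕ → Val D) (x : ℕ) (e : PExp) :
      Run (.assign x e) s (e.cost + 1) (Function.update s x (e.eval s))
  | seq {P Q : Prog} {s s' s'' : ℕ → Val D} {k l : ℕ} :
      Run P s k s' → Run Q s' l s'' → Run (.seq P Q) s (k + l + 1) s''
  | iteTrue {e : PExp} {P Q : Prog} {s s' : ℕ → Val D} {k : ℕ} :
      e.eval s ≠ .nil → Run P s k s' → Run (.ite e P Q) s (e.cost + k + 1) s'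
  | iteFalse {e : PExp} {P Q : Prog} {s s' : ℕ → Val D} {k : ℕ} :
      e.eval s = .nil → Run Q s k s' → Run (.ite e P Q) s (e.cost + k + 1) s'
  | loopStop {e : PExp} {P : Prog} {s : ℕ → Val D} :
      e.eval s = .nil → Run (.loop e P) s (e.cost + 1) s
  | loopStep {e : PExp} {P : Prog} {s s' s'' : ℕ → Val D} {k l : ℕ} :
      e.eval s ≠ .nil → Run P s k s' → Run (.loop e P) s' l s'' →
        Run (.loop e P) s (e.cost + k + l + 1) s''

/-- The initial store: the input in variable `0`, all other variables `nil`. -/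
def initStore {D : Type*} (x : Val D) : ℕ → Val D := Function.update (fun _ => .nil) 0 x

/-! ### Representation of star-cylinders as values -/

/-- Lists as values. -/
def Val.ofList {D : Type*} : List (Val D) → Val D
  | [] => .nil
  | x :: l => .cons x (Val.ofList l)

/-- Numbers in unary (used for column numbers and tags only). -/
def Val.ofNat {D : Type*} : ℕ → Val D
  | 0 => .nil
  | k + 1 => .cons .nil (Val.ofNat k)

section

variable {n m : ℕ} {D : Type*}

def entryCode : Option D → Val D
  | none => .nil
  | some a => .atom a

/-- The code of the pair `{i, j}` with `i ≤ j` lists `i` and `j`. -/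
def pairCode (p : Sym2 (Fin n)) : Val D := .cons (.ofNat p.inf) (.ofNat p.sup)

def Lit.code : Lit n D → Val D
  | .eq p => .cons (.ofNat 0) (pairCode p)
  | .ne p => .cons (.ofNat 1) (pairCode p)
  | .neConst i a => .cons (.ofNat 2) (.cons (.ofNat i) (.atom a))

/-- `x` represents `t`: the list of entries, and the literals listed in any order without
repetition. -/
def TupleCode (x : Val D) (t : StarTuple n D) : Prop :=
  ∃ L : List (Lit n D), L.Nodup ∧ L.toFinset = t.cond ∧
    x = .cons (.ofList (List.ofFn fun i => entryCode (t.val i))) (.ofList (L.map Lit.code))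

/-- `x` represents `C`: the star-tuples listed in any order without repetition. -/
def CylCode (x : Val D) (C : StarCyl n D) : Prop :=
  ∃ (L : List (StarTuple n D)) (X : List (Val D)), L.Nodup ∧ L.toFinset = C ∧
    List.Forall₂ TupleCode X L ∧ x = .ofList X

/-- `x` represents the sequence `C`. -/
def SeqCode (x : Val D) (C : Fin m → StarCyl n D) : Prop :=
  ∃ X : Fin m → Val D, (∀ p, CylCode (X p) (C p)) ∧ x = .ofList (List.ofFn X)

/-- The program `P` computes the star-cylinder `R` from the sequence `C` within `T` steps: started
on any representation of `C` it halts after at most `T` steps, with a representation of `R` in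
variable `0`. -/
def ComputesWithin (P : Prog) (C : Fin m → StarCyl n D) (R : StarCyl n D) (T : ℕ) : Prop :=
  ∀ x, SeqCode x C → ∃ k s, k ≤ T ∧ Run P (initStore x) k s ∧ CylCode (s 0) R

end

end SCA

end

/-!
The operators of the star algebra are computed by brute force, and the polynomial bounds come from
the shape of the programs alone.

*Programs.* A function on values is called `PolyTime` if a program computes it in polynomially many
steps with a result of polynomial size. This class is closed under composition, pairing and
branching, and under loops that run through the tails of a list, evaluate a function of the class on
each of them, and only concatenate the results (`PolyTime.val_tails`). No round of such a loop sees
the results of the earlier rounds, so that sizes cannot grow exponentially. As the loops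
may be nested, everything that can be written with list comprehensions, case distinctions on
columns, and equality tests of atoms is polynomial; `PolyFun` and `PolyPred` are the versions for
functions and predicates on coded types.

*Semantics.* Satisfiability of a star-tuple, implication of a literal and forced entries quantify
over ordinary tuples, i.e. over an infinite set. Only equalities between entries and with the
constants of the star-tuple matter, and so it is enough to let the `n` entries run through these
constants and `n` fresh elements (`exists_world`, `exists_tuple`, `forall_holds_iff`). As `n` is
fixed, there are polynomially many such worlds, and they are listed by a comprehension. The
condition of a normal form is then a filter on the list of all literals over the constants, and the
sieve is a filter on a list of polynomially many candidates.

Hence each operator has a version on lists of star-tuples that is visibly a `PolyFun` and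
that yields the same star-cylinder (`toCyl_evalList`, `toCyl_evalPosList`). Repetitions are ignored
until the end, when `dedupCyl` removes them. The bound on the size of the value need not be proved
separately: the program writes the value down, so that it fits into an output of polynomial size
(`exists_program`).
-/

noncomputable section

open scoped Classical

namespace SCA

/-! ### Functions on values computed by programs in polynomial time -/

section

variable {D : Type*}

/-- The number of nodes of a value. -/
def Val.sz : Val D → ℕ
  | .nil => 1
  | .atom _ => 1
  | .cons x y => x.sz + y.sz + 1

/-- The values of `x, tl x, tl (tl x), …` before the first `nil`: what a loop that replaces its
variable by its tail runs through. -/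
def Val.tails : Val D → List (Val D)
  | .nil => []
  | .atom a => [.atom a]
  | .cons x y => .cons x y :: y.tails

/-- The heads of the elements of `Val.tails`. -/
def Val.toList : Val D → List (Val D)
  | .nil => []
  | .atom _ => [.nil]
  | .cons x y => x :: y.toList

theorem Val.toList_ofList (l : List (Val D)) : (Val.ofList l).toList = l := by
  induction l with
  | nil => rfl
  | cons x l ih => simp [Val.ofList, Val.toList, ih]

theorem Val.sz_hd_le (x : Val D) : x.hd.sz ≤ x.sz := by
  cases x <;> simp [Val.sz, Val.hd]; omega

theorem Val.sz_tl_le (x : Val D) : x.tl.sz ≤ x.sz := by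
  cases x <;> simp [Val.sz, Val.tl]; omega

theorem Val.length_tails_le (x : Val D) : x.tails.length ≤ x.sz := by
  induction x with
  | nil => simp [Val.tails]
  | atom a => simp [Val.tails, Val.sz]
  | cons x y _ ih => simp [Val.tails, Val.sz]; omega

theorem Val.sz_le_of_mem_tails {x t : Val D} (h : t ∈ x.tails) : t.sz ≤ x.sz := by
  induction x with
  | nil => simp [Val.tails] at h
  | atom a => simp only [Val.tails, List.mem_singleton] at h; rw [h]
  | cons x y _ ih =>
    rcases List.mem_cons.1 h with rfl | h
    · rfl
    · exact (ih h).trans (by simp [Val.sz]; omega)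

theorem Val.sz_ofList (l : List (Val D)) :
    (Val.ofList l).sz = (l.map fun x => x.sz + 1).sum + 1 := by
  induction l with
  | nil => rfl
  | cons x l ih => simp [Val.ofList, Val.sz, ih]; omega

theorem Val.sum_toList_le (x : Val D) : (x.toList.map fun y => y.sz + 1).sum ≤ 2 * x.sz := by
  induction x with
  | nil => simp [Val.toList]
  | atom a => simp [Val.toList, Val.sz]
  | cons x y _ ih =>
    simp only [Val.toList, Val.sz, List.map_cons, List.sum_cons]
    omega

theorem Val.length_le_sum (l : List (Val D)) : l.length ≤ (l.map fun y => y.sz + 1).sum := by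
  induction l with
  | nil => simp
  | cons x l ih => simp; omega

/-- `f` is computed in polynomial time. Programs are relocatable: for each `b` there is one that
replaces the content of variable `b` by its image, and that leaves the variables below `b` alone
and may use those above `b`, whatever they hold. -/
def PolyTime (f : Val D → Val D) : Prop :=
  ∃ p : Polynomial ℕ, (∀ x, (f x).sz ≤ p.eval x.sz) ∧ ∀ b, ∃ P : Prog, ∀ s : ℕ → Val D,
    ∃ k s', k ≤ p.eval (s b).sz ∧ Run P s k s' ∧ s' b = f (s b) ∧ ∀ y < b, s' y = s y

theorem eval_le_eval (p : Polynomial ℕ) {a b : ℕ} (h : a ≤ b) : p.eval a ≤ p.eval b := by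
  rw [Polynomial.eval_eq_sum, Polynomial.eval_eq_sum]
  exact Finset.sum_le_sum fun i _ => Nat.mul_le_mul_left _ (Nat.pow_le_pow_left h i)

/-- A single assignment computes its expression in constant time. -/
theorem PolyTime.of_exp (f : Val D → Val D) (e : ℕ → PExp) (c : ℕ)
    (h : ∀ b (s : ℕ → Val D), (e b).eval s = f (s b)) (hc : ∀ b, (e b).cost ≤ c)
    (hs : ∀ x, (f x).sz ≤ x.sz + c) : PolyTime f := by
  refine ⟨Polynomial.X + Polynomial.C (c + 1), fun x => ?_, fun b => ⟨.assign b (e b), fun s =>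
    ⟨_, _, ?_, .assign s b (e b), ?_, ?_⟩⟩⟩
  · have := hs x
    simp; omega
  · have := hc b
    simp; omega
  · simp [h]
  · intro y hy
    simp [hy.ne]

theorem PolyTime.id : PolyTime fun x : Val D => x :=
  .of_exp _ (fun b => .var b) 1 (fun _ _ => rfl) (fun _ => le_rfl) fun x => by simp

theorem PolyTime.nil : PolyTime fun _ : Val D => .nil :=
  .of_exp _ (fun _ => .nil) 1 (fun _ _ => rfl) (fun _ => le_rfl) fun x => by simp [Val.sz]

theorem PolyTime.val_hd : PolyTime (Val.hd : Val D → Val D) :=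
  .of_exp _ (fun b => .hd (.var b)) 2 (fun _ _ => rfl) (fun _ => le_rfl)
    fun x => x.sz_hd_le.trans (by simp)

theorem PolyTime.val_tl : PolyTime (Val.tl : Val D → Val D) :=
  .of_exp _ (fun b => .tl (.var b)) 2 (fun _ _ => rfl) (fun _ => le_rfl)
    fun x => x.sz_tl_le.trans (by simp)

theorem Val.sz_atomEq_le (x y : Val D) : (x.atomEq y).sz ≤ 3 := by
  unfold Val.atomEq
  split
  · split <;> simp [Val.sz]
  · simp [Val.sz]

theorem PolyTime.val_atomEq : PolyTime fun x : Val D => x.hd.atomEq x.tl :=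
  .of_exp _ (fun b => .atomEq (.hd (.var b)) (.tl (.var b))) 5 (fun _ _ => rfl)
    (fun _ => le_rfl) fun x => (Val.sz_atomEq_le _ _).trans (by omega)

theorem PolyTime.comp {g f : Val D → Val D} (hg : PolyTime g) (hf : PolyTime f) :
    PolyTime fun x => g (f x) := by
  obtain ⟨p, hp, hP⟩ := hf
  obtain ⟨q, hq, hQ⟩ := hg
  refine ⟨p + q.comp p + 1, fun x => ?_, fun b => ?_⟩
  · have := (hq (f x)).trans (eval_le_eval q (hp x))
    simp; omega
  · obtain ⟨P, hP⟩ := hP b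
    obtain ⟨Q, hQ⟩ := hQ b
    refine ⟨.seq P Q, fun s => ?_⟩
    obtain ⟨k, s', hk, hr, h1, h2⟩ := hP s
    obtain ⟨l, s'', hl, hr', h1', h2'⟩ := hQ s'
    refine ⟨_, _, ?_, .seq hr hr', ?_, fun y hy => (h2' y hy).trans (h2 y hy)⟩
    · rw [h1] at hl
      have := hl.trans (eval_le_eval q (hp _))
      simp; omega
    · rw [h1', h1]

theorem PolyTime.cons {f g : Val D → Val D} (hf : PolyTime f) (hg : PolyTime g) :
    PolyTime fun x => .cons (f x) (g x) := by
  obtain ⟨p, hp, hP⟩ := hf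
  obtain ⟨q, hq, hQ⟩ := hg
  refine ⟨p + q + 12, fun x => ?_, fun b => ?_⟩
  · have := hq x
    have := hp x
    simp [Val.sz]; omega
  · obtain ⟨P, hP⟩ := hP (b + 1)
    obtain ⟨Q, hQ⟩ := hQ (b + 2)
    refine ⟨.seq (.seq (.assign (b + 1) (.var b)) P) (.seq (.seq (.assign (b + 2) (.var b)) Q)
      (.assign b (.cons (.var (b + 1)) (.var (b + 2))))), fun s => ?_⟩
    obtain ⟨k, s', hk, hr, h1, h2⟩ := hP (Function.update s (b + 1) (s b))
    obtain ⟨l, s'', hl, hr', h1', h2'⟩ := hQ (Function.update s' (b + 2) (s' b))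
    have hb : s' b = s b := by rw [h2 b (by omega)]; simp
    refine ⟨_, _, ?_, .seq (.seq (.assign _ _ _) hr) (.seq (.seq (.assign _ _ _) hr')
      (.assign _ _ _)), ?_, fun y hy => ?_⟩
    · simp [hb] at hk hl
      simp [PExp.cost]; omega
    · simp only [PExp.eval, Function.update_self]
      rw [h1', h2' (b + 1) (by omega)]
      simp [h1, hb]
    · rw [Function.update_of_ne (by omega), h2' y (by omega), Function.update_of_ne (by omega),
        h2 y (by omega), Function.update_of_ne (by omega)]

theorem PolyTime.ite {c f g : Val D → Val D} (hc : PolyTime c) (hf : PolyTime f)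
    (hg : PolyTime g) : PolyTime fun x => if c x = .nil then g x else f x := by
  obtain ⟨r, hr, hR⟩ := hc
  obtain ⟨p, hp, hP⟩ := hf
  obtain ⟨q, hq, hQ⟩ := hg
  refine ⟨r + p + q + 12, fun x => ?_, fun b => ?_⟩
  · have := hq x
    have := hp x
    dsimp only
    split <;> simp <;> omega
  · obtain ⟨R, hR⟩ := hR (b + 1)
    obtain ⟨P, hP⟩ := hP b
    obtain ⟨Q, hQ⟩ := hQ b
    refine ⟨.seq (.seq (.assign (b + 1) (.var b)) R) (.ite (.var (b + 1)) P Q), fun s => ?_⟩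
    obtain ⟨k, s', hk, hr, h1, h2⟩ := hR (Function.update s (b + 1) (s b))
    have hb : s' b = s b := by rw [h2 b (by omega)]; simp
    simp only [Function.update_self] at h1 hk
    by_cases hn : c (s b) = .nil
    · obtain ⟨l, s'', hl, hr', h1', h2'⟩ := hQ s'
      refine ⟨_, _, ?_, .seq (.seq (.assign _ _ _) hr)
        (.iteFalse (by simpa [PExp.eval, h1] using hn) hr'), ?_, fun y hy => ?_⟩
      · rw [hb] at hl
        simp [PExp.cost]; omega
      · simp [h1', hb, hn]
      · rw [h2' y hy, h2 y (by omega), Function.update_of_ne (by omega)]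
    · obtain ⟨l, s'', hl, hr', h1', h2'⟩ := hP s'
      refine ⟨_, _, ?_, .seq (.seq (.assign _ _ _) hr)
        (.iteTrue (by simpa [PExp.eval, h1] using hn) hr'), ?_, fun y hy => ?_⟩
      · rw [hb] at hl
        simp [PExp.cost]; omega
      · simp [h1', hb, hn]
      · rw [h2' y hy, h2 y (by omega), Function.update_of_ne (by omega)]

/-- The program that moves the elements of the list in variable `i` one by one to the front of the
list in variable `j`. -/
def moveProg (i j : ℕ) : Prog :=
  .loop (.var i) (.seq (.assign j (.cons (.hd (.var i)) (.var j))) (.assign i (.tl (.var i))))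

theorem run_moveProg {i j : ℕ} (hij : i ≠ j) (v : Val D) :
    ∀ (s : ℕ → Val D) (L : List (Val D)),
    s i = v → s j = .ofList L → ∃ s', Run (moveProg i j) s (11 * v.toList.length + 2) s' ∧
      s' j = .ofList (v.toList.reverse ++ L) ∧ ∀ y, y ≠ i → y ≠ j → s' y = s y := by
  -- One round, for any value other than `nil`; an atom counts as a list with the one element `nil`.
  have step : ∀ (v : Val D) (s : ℕ → Val D) (L : List (Val D)), v ≠ .nil → s i = v →
      s j = .ofList L → (∀ (s : ℕ → Val D) (L : List (Val D)), s i = v.tl → s j = .ofList L →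
        ∃ s', Run (moveProg i j) s (11 * v.tl.toList.length + 2) s' ∧
          s' j = .ofList (v.tl.toList.reverse ++ L) ∧ ∀ y, y ≠ i → y ≠ j → s' y = s y) →
      ∃ s', Run (moveProg i j) s (11 * (v.hd :: v.tl.toList).length + 2) s' ∧
        s' j = .ofList ((v.hd :: v.tl.toList).reverse ++ L) ∧
          ∀ y, y ≠ i → y ≠ j → s' y = s y := by
    intro v s L hv hi hj ih
    have e2 : (Function.update s j (.cons v.hd (s j))) i = v := by simp [hij, hi]
    obtain ⟨s', hr, h1, h2⟩ := ih (Function.update (Function.update s j (.cons v.hd (s j))) i v.tl)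
      (v.hd :: L) (by simp) (by simp [hij.symm, hj, Val.ofList])
    refine ⟨s', ?_, by simp [h1], fun y h h' => by simp [h2 y h h', h, h']⟩
    have e : 11 * (v.hd :: v.tl.toList).length + 2 =
        (PExp.var i).cost + (((PExp.cons (.hd (.var i)) (.var j)).cost + 1) +
          ((PExp.tl (.var i)).cost + 1) + 1) + (11 * v.tl.toList.length + 2) + 1 := by
      simp [PExp.cost]; ring
    rw [e]
    refine .loopStep (by simpa [PExp.eval, hi]) (.seq (.assign _ _ _) (.assign _ _ _)) ?_
    simpa [PExp.eval, hi, e2, moveProg] using hr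
  induction v with
  | nil =>
    intro s L hi hj
    exact ⟨s, .loopStop (by simpa [PExp.eval]), by simpa [Val.toList], fun _ _ _ => rfl⟩
  | atom a =>
    intro s L hi hj
    refine step (.atom a) s L (by simp) hi hj fun s L hi hj => ?_
    exact ⟨s, .loopStop (by simpa [PExp.eval]), by simpa [Val.toList, Val.tl], fun _ _ _ => rfl⟩
  | cons x y _ ih =>
    intro s L hi hj
    exact step (.cons x y) s L (by simp) hi hj ih

/-- The program that, for each `t` among the tails of variable `b + 1`, runs `G` on the pair of `t`
and the content of variable `b`, and moves the resulting list to the front of variable `b + 2`. -/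
def tailsProg (b : ℕ) (G : Prog) : Prog :=
  .loop (.var (b + 1)) (.seq (.assign (b + 3) (.cons (.var (b + 1)) (.var b)))
    (.seq G (.seq (moveProg (b + 3) (b + 2)) (.assign (b + 1) (.tl (.var (b + 1)))))))

/-- `M` bounds the cost of running `G` and of moving its result, for each tail. The results are
collected in reverse order. -/
theorem run_tailsProg {b : ℕ} {G : Prog} {g : Val D → Val D} {p : Polynomial ℕ} {x : Val D}
    {M : ℕ} (hG : ∀ s : ℕ → Val D, ∃ k s', k ≤ p.eval (s (b + 3)).sz ∧ Run G s k s' ∧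
      s' (b + 3) = g (s (b + 3)) ∧ ∀ y < b + 3, s' y = s y) (v : Val D) :
    (∀ t ∈ v.tails, p.eval (Val.cons t x).sz + 11 * (g (.cons t x)).toList.length ≤ M) →
    ∀ (s : ℕ → Val D) (L : List (Val D)), s b = x → s (b + 1) = v → s (b + 2) = .ofList L →
    ∃ k s', k ≤ (M + 20) * v.tails.length + 2 ∧ Run (tailsProg b G) s k s' ∧
      s' (b + 2) = .ofList ((v.tails.flatMap fun t => (g (.cons t x)).toList).reverse ++ L) ∧
      ∀ y < b, s' y = s y := by
  have base : ∀ (s : ℕ → Val D) (L : List (Val D)), s (b + 1) = .nil → s (b + 2) = .ofList L →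
      ∃ k s', k ≤ 2 ∧ Run (tailsProg b G) s k s' ∧ s' (b + 2) = .ofList L ∧
        ∀ y < b, s' y = s y := fun s L hv hL =>
    ⟨_, s, le_rfl, .loopStop (by simpa [PExp.eval]), hL, fun _ _ => rfl⟩
  -- One round, for any value other than `nil`.
  have step : ∀ v : Val D, v ≠ .nil → v.tails = v :: v.tl.tails →
      (∀ t ∈ v.tails, p.eval (Val.cons t x).sz + 11 * (g (.cons t x)).toList.length ≤ M) →
      (∀ (s : ℕ → Val D) (L : List (Val D)), s b = x → s (b + 1) = v.tl → s (b + 2) = .ofList L →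
        ∃ k s', k ≤ (M + 20) * v.tl.tails.length + 2 ∧ Run (tailsProg b G) s k s' ∧
          s' (b + 2) =
            .ofList ((v.tl.tails.flatMap fun t => (g (.cons t x)).toList).reverse ++ L) ∧
          ∀ y < b, s' y = s y) →
      ∀ (s : ℕ → Val D) (L : List (Val D)), s b = x → s (b + 1) = v → s (b + 2) = .ofList L →
      ∃ k s', k ≤ (M + 20) * v.tails.length + 2 ∧ Run (tailsProg b G) s k s' ∧
        s' (b + 2) = .ofList ((v.tails.flatMap fun t => (g (.cons t x)).toList).reverse ++ L) ∧
        ∀ y < b, s' y = s y := by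
    intro v hv ht hM ih s L hx hb hL
    obtain ⟨k, s1, hk, hr, h1, h2⟩ := hG (Function.update s (b + 3) (.cons v x))
    simp only [Function.update_self] at hk h1
    obtain ⟨s2, hr2, h3, h4⟩ := run_moveProg (i := b + 3) (j := b + 2) (by omega) _ s1 L h1
      (by rw [h2 _ (by omega), Function.update_of_ne (by omega), hL])
    have hlow : ∀ y < b + 2, s2 y = s y := fun y hy => by
      rw [h4 y (by omega) (by omega), h2 y (by omega), Function.update_of_ne (by omega)]
    obtain ⟨l, s3, hl, hr3, h5, h6⟩ := ih (Function.update s2 (b + 1) v.tl)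
      ((g (.cons v x)).toList.reverse ++ L)
      (by rw [Function.update_of_ne (by omega), hlow _ (by omega), hx]) (by simp)
      (by rw [Function.update_of_ne (by omega), h3])
    have hb2 : s2 (b + 1) = v := by rw [hlow _ (by omega), hb]
    have hra : Run (.assign (b + 3) (.cons (.var (b + 1)) (.var b))) s 4
        (Function.update s (b + 3) (.cons v x)) := by
      have := Run.assign s (b + 3) (.cons (.var (b + 1)) (.var b))
      simpa [PExp.eval, PExp.cost, hb, hx] using this
    have hrb : Run (.assign (b + 1) (.tl (.var (b + 1)))) s2 3
        (Function.update s2 (b + 1) v.tl) := by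
      have := Run.assign s2 (b + 1) (.tl (.var (b + 1)))
      simpa [PExp.eval, PExp.cost, hb2] using this
    refine ⟨_, s3, ?_, .loopStep (by simpa [PExp.eval, hb]) (.seq hra (.seq hr (.seq hr2 hrb))) hr3,
      ?_, fun y hy => ?_⟩
    · have := hM v (by rw [ht]; simp)
      rw [ht]
      simp only [PExp.cost, List.length_cons, Nat.mul_add]
      omega
    · rw [h5, ht]
      simp
    · rw [h6 y hy, Function.update_of_ne (by omega), hlow y (by omega)]
  induction v with
  | nil =>
    intro _ s L _ hv hL
    simpa [Val.tails] using base s L hv hL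
  | atom a =>
    intro hM
    refine step (.atom a) (by simp) rfl hM fun s L _ hv hL => ?_
    simpa [Val.tails, Val.tl] using base s L hv hL
  | cons y z _ ih =>
    intro hM
    exact step (.cons y z) (by simp) rfl hM (ih fun t ht => hM t (List.mem_cons_of_mem _ ht))

/-- A loop over all tails of a list that concatenates the lists obtained from them. Since the
results are only collected, but not fed into the next round, both their size and the running time
remain polynomial. -/
theorem PolyTime.val_tails {g : Val D → Val D} (hg : PolyTime g) :
    PolyTime fun x => Val.ofList (x.hd.tails.flatMap fun t => (g (.cons t x.tl)).toList) := by
  obtain ⟨p, hp, hP⟩ := hg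
  set q : Polynomial ℕ := p.comp (2 * Polynomial.X + 1) with hq
  have hq' : ∀ N, q.eval N = p.eval (2 * N + 1) := fun N => by simp [hq]
  have hsz : ∀ x : Val D, ∀ t ∈ x.hd.tails, (Val.cons t x.tl).sz ≤ 2 * x.sz + 1 := fun x t ht => by
    have := Val.sz_le_of_mem_tails ht
    have := x.sz_hd_le
    have := x.sz_tl_le
    simp [Val.sz]; omega
  have hpe : ∀ x : Val D, ∀ t ∈ x.hd.tails, p.eval (Val.cons t x.tl).sz ≤ q.eval x.sz :=
    fun x t ht => (eval_le_eval p (hsz x t ht)).trans_eq (hq' _).symm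
  have hsum : ∀ x : Val D, ∀ t ∈ x.hd.tails,
      ((g (.cons t x.tl)).toList.map fun y => y.sz + 1).sum ≤ 2 * q.eval x.sz := fun x t ht =>
    (Val.sum_toList_le _).trans (Nat.mul_le_mul_left 2 ((hp _).trans (hpe x t ht)))
  have hlen : ∀ x : Val D, x.hd.tails.length ≤ x.sz := fun x =>
    (Val.length_tails_le _).trans x.sz_hd_le
  have htot : ∀ x : Val D, ((x.hd.tails.flatMap fun t => (g (.cons t x.tl)).toList).map
      fun y => y.sz + 1).sum ≤ x.sz * (2 * q.eval x.sz) := by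
    intro x
    have key : ∀ l : List (Val D), (∀ t ∈ l, t ∈ x.hd.tails) →
        ((l.flatMap fun t => (g (.cons t x.tl)).toList).map fun y => y.sz + 1).sum ≤
          l.length * (2 * q.eval x.sz) := by
      intro l
      induction l with
      | nil => simp
      | cons t l ih =>
        intro h
        have h1 := hsum x t (h t (by simp))
        have h2 := ih fun u hu => h u (by simp [hu])
        rw [List.flatMap_cons, List.map_append, List.sum_append, List.length_cons, Nat.succ_mul]
        omega
    exact (key _ fun _ h => h).trans (Nat.mul_le_mul_right _ (hlen x))
  refine ⟨(q + 22 * q + 20) * Polynomial.X + 11 * (Polynomial.X * (2 * q)) + 40, fun x => ?_,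
    fun b => ?_⟩
  · rw [Val.sz_ofList]
    have := htot x
    simp only [Polynomial.eval_add, Polynomial.eval_mul, Polynomial.eval_X,
      Polynomial.eval_ofNat]
    omega
  · obtain ⟨G, hG⟩ := hP (b + 3)
    refine ⟨.seq (.seq (.assign (b + 1) (.hd (.var b))) (.seq (.assign b (.tl (.var b)))
      (.assign (b + 2) .nil))) (.seq (tailsProg b G) (.seq (.assign b .nil)
      (moveProg (b + 2) b))), fun s => ?_⟩
    set x := s b with hx
    set s0 := Function.update (Function.update (Function.update s (b + 1) x.hd) b x.tl) (b + 2)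
      .nil with hs0
    obtain ⟨k, s1, hk, hr, h1, h2⟩ := run_tailsProg (x := x.tl)
      (M := q.eval x.sz + 22 * q.eval x.sz)
      hG x.hd (fun t ht => by
        have h1 := hpe x t ht
        have h2 := (Val.length_le_sum _).trans (hsum x t ht)
        omega) s0 [] (by simp [hs0])
      (by simp [hs0])
      (by simp [hs0, Val.ofList])
    obtain ⟨s2, hr2, h3, h4⟩ := run_moveProg (i := b + 2) (j := b) (by omega) _
      (Function.update s1 b .nil) [] (by rw [Function.update_of_ne (by omega), h1])
      (by simp [Val.ofList])
    rw [Val.toList_ofList] at h3 hr2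
    have hra : Run (.seq (.assign (b + 1) (.hd (.var b))) (.seq (.assign b (.tl (.var b)))
        (.assign (b + 2) .nil))) s (3 + (3 + 2 + 1) + 1) s0 := by
      have e1 := Run.assign s (b + 1) (.hd (.var b))
      have e2 := Run.assign (Function.update s (b + 1) x.hd) b (.tl (.var b))
      have e3 := Run.assign (Function.update (Function.update s (b + 1) x.hd) b x.tl) (b + 2) .nil
      simp only [PExp.eval, PExp.cost, ← hx] at e1 e2 e3
      rw [Function.update_of_ne (by omega), ← hx] at e2
      exact .seq e1 (.seq e2 e3)
    have hrb : Run (.assign b .nil) s1 2 (Function.update s1 b .nil) := .assign s1 b .nil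
    refine ⟨_, s2, ?_, .seq hra (.seq hr (.seq hrb hr2)), ?_, fun y hy => ?_⟩
    · have e1 := (Val.length_le_sum _).trans (htot x)
      have e2 := Nat.mul_le_mul_left (q.eval x.sz + 22 * q.eval x.sz + 20) (hlen x)
      simp only [Polynomial.eval_add, Polynomial.eval_mul, Polynomial.eval_X,
        Polynomial.eval_ofNat, List.length_append, List.length_reverse, List.length_nil]
      omega
    · rw [h3]
      simp
    · rw [h4 y (by omega) (by omega), Function.update_of_ne (by omega), h2 y hy, hs0,
        Function.update_of_ne (by omega), Function.update_of_ne (by omega),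
        Function.update_of_ne (by omega)]

theorem PolyTime.hd {f : Val D → Val D} (hf : PolyTime f) : PolyTime fun x => (f x).hd :=
  val_hd.comp hf

theorem PolyTime.tl {f : Val D → Val D} (hf : PolyTime f) : PolyTime fun x => (f x).tl :=
  val_tl.comp hf

theorem PolyTime.atomEq {f g : Val D → Val D} (hf : PolyTime f) (hg : PolyTime g) :
    PolyTime fun x => (f x).atomEq (g x) :=
  val_atomEq.comp (hf.cons hg)

end

/-! ### Polynomial-time functions between coded types -/

section

variable {D : Type*}

/-- Types whose elements are represented by values. Injectivity of the code is not required: where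
equality has to be decided, this is proved for the type in question. -/
class Code (D : Type*) (α : Type*) where
  /-- The value that represents an element. -/
  code : α → Val D

open Code

instance : Code D D := ⟨.atom⟩

instance : Code D (Option D) := ⟨entryCode⟩

instance : Code D Bool := ⟨fun b => if b then .cons .nil .nil else .nil⟩

instance {n : ℕ} : Code D (Fin n) := ⟨fun i => .ofNat i⟩

instance {n : ℕ} : Code D (Sym2 (Fin n)) := ⟨pairCode⟩

instance {n : ℕ} : Code D (Lit n D) := ⟨Lit.code⟩

instance {n : ℕ} : Code D (D ⊕ Fin n) := ⟨Sum.elim .atom fun i => .ofNat i⟩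

instance {α : Type*} [Code D α] : Code D (List α) := ⟨fun l => .ofList (l.map code)⟩

instance {α β : Type*} [Code D α] [Code D β] : Code D (α × β) :=
  ⟨fun q => .cons (code q.1) (code q.2)⟩

instance {k : ℕ} {α : Type*} [Code D α] : Code D (Fin k → α) :=
  ⟨fun f => .ofList (List.ofFn fun i => code (f i))⟩

variable {α β γ : Type*} [Code D α] [Code D β] [Code D γ]

variable (D) in
/-- `f` is realized by a polynomial-time function on codes. -/
def PolyFun (f : α → β) : Prop := ∃ F : Val D → Val D, PolyTime F ∧ ∀ a, F (code a) = code (f a)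

variable (D) in
/-- `p` is decided in polynomial time. -/
def PolyPred (p : α → Prop) : Prop := PolyFun D fun a => decide (p a)

theorem PolyFun.congr {f g : α → β} (hf : PolyFun D f) (h : ∀ a, f a = g a) : PolyFun D g :=
  (funext h : f = g) ▸ hf

theorem PolyPred.congr {p q : α → Prop} (hp : PolyPred D p) (h : ∀ a, p a ↔ q a) : PolyPred D q :=
  (funext fun a => propext (h a) : p = q) ▸ hp

theorem PolyFun.id : PolyFun D fun a : α => a := ⟨_, .id, fun _ => rfl⟩

theorem PolyFun.comp {g : β → γ} {f : α → β} (hg : PolyFun D g) (hf : PolyFun D f) :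
    PolyFun D fun a => g (f a) := by
  obtain ⟨G, hG, hg⟩ := hg
  obtain ⟨F, hF, hf⟩ := hf
  exact ⟨_, hG.comp hF, fun a => by rw [hf, hg]⟩

theorem PolyPred.comp {p : β → Prop} {f : α → β} (hp : PolyPred D p) (hf : PolyFun D f) :
    PolyPred D fun a => p (f a) := PolyFun.comp hp hf

theorem PolyFun.pair {f : γ → α} {g : γ → β} (hf : PolyFun D f) (hg : PolyFun D g) :
    PolyFun D fun c => (f c, g c) := by
  obtain ⟨F, hF, hf⟩ := hf
  obtain ⟨G, hG, hg⟩ := hg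
  exact ⟨_, hF.cons hG, fun c => by rw [hf, hg]; rfl⟩

theorem PolyFun.fst {f : γ → α × β} (hf : PolyFun D f) : PolyFun D fun c => (f c).1 := by
  obtain ⟨F, hF, hf⟩ := hf
  exact ⟨_, hF.hd, fun c => by rw [hf]; rfl⟩

theorem PolyFun.snd {f : γ → α × β} (hf : PolyFun D f) : PolyFun D fun c => (f c).2 := by
  obtain ⟨F, hF, hf⟩ := hf
  exact ⟨_, hF.tl, fun c => by rw [hf]; rfl⟩

theorem PolyFun.ite {p : γ → Prop} [∀ c, Decidable (p c)] {f g : γ → α} (hp : PolyPred D p)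
    (hf : PolyFun D f) (hg : PolyFun D g) : PolyFun D fun c => if p c then f c else g c := by
  obtain ⟨P, hP, hp⟩ := hp
  obtain ⟨F, hF, hf⟩ := hf
  obtain ⟨G, hG, hg⟩ := hg
  refine ⟨_, hP.ite hF hG, fun c => ?_⟩
  by_cases h : p c <;> simp [hp, hf, hg, h, code]

/-! ### Logical connectives and finite case distinctions -/

theorem PolyFun.bool (b : Bool) : PolyFun D fun _ : γ => b := by
  cases b
  · exact ⟨_, .nil, fun c => by simp [code]⟩
  · exact ⟨_, PolyTime.nil.cons .nil, fun c => by simp [code]⟩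

theorem PolyPred.const (P : Prop) : PolyPred D fun _ : γ => P := PolyFun.bool _

theorem PolyPred.cond {p q r : γ → Prop} (hp : PolyPred D p) (hq : PolyPred D q)
    (hr : PolyPred D r) : PolyPred D fun c => (p c ∧ q c) ∨ (¬ p c ∧ r c) :=
  (PolyFun.ite hp hq hr).congr fun c => by by_cases h : p c <;> simp [h]

theorem PolyPred.not {p : γ → Prop} (hp : PolyPred D p) : PolyPred D fun c => ¬ p c :=
  (hp.cond (.const False) (.const True)).congr fun c => by simp

theorem PolyPred.and {p q : γ → Prop} (hp : PolyPred D p) (hq : PolyPred D q) :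
    PolyPred D fun c => p c ∧ q c :=
  (hp.cond hq (.const False)).congr fun c => by simp

theorem PolyPred.or {p q : γ → Prop} (hp : PolyPred D p) (hq : PolyPred D q) :
    PolyPred D fun c => p c ∨ q c :=
  (hp.cond (.const True) hq).congr fun c => by tauto

theorem PolyPred.imp {p q : γ → Prop} (hp : PolyPred D p) (hq : PolyPred D q) :
    PolyPred D fun c => p c → q c :=
  (hp.cond hq (.const True)).congr fun c => by tauto

theorem PolyPred.forall_finset {ι : Type*} {p : ι → γ → Prop} (hp : ∀ i, PolyPred D (p i))
    (s : Finset ι) : PolyPred D fun c => ∀ i ∈ s, p i c := by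
  induction s using Finset.induction_on with
  | empty => exact (PolyPred.const True).congr fun c => by simp
  | insert a s _ ih => exact ((hp a).and ih).congr fun c => by simp

theorem PolyPred.forall_finite {ι : Type*} [Finite ι] {p : ι → γ → Prop}
    (hp : ∀ i, PolyPred D (p i)) : PolyPred D fun c => ∀ i, p i c := by
  have := Fintype.ofFinite ι
  exact (PolyPred.forall_finset hp Finset.univ).congr fun c => by simp

theorem PolyPred.exists_finite {ι : Type*} [Finite ι] {p : ι → γ → Prop}
    (hp : ∀ i, PolyPred D (p i)) : PolyPred D fun c => ∃ i, p i c :=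
  (PolyPred.forall_finite fun i => (hp i).not).not.congr fun c => by simp

/-- A case distinction between finitely many unary numbers. -/
theorem PolyTime.ofNat_cases {n : ℕ} {g : Val D → Val D} (hg : PolyTime g)
    {f : Fin n → Val D → Val D} (hf : ∀ i, PolyTime (f i)) :
    ∃ F : Val D → Val D, PolyTime F ∧ ∀ x (i : Fin n), g x = .ofNat i → F x = f i x := by
  induction n generalizing g with
  | zero => exact ⟨_, .nil, fun x i => i.elim0⟩
  | succ n ih =>
    obtain ⟨F, hF, h⟩ := ih hg.tl fun i => hf i.succ
    refine ⟨_, hg.ite hF (hf 0), fun x i hi => ?_⟩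
    cases i using Fin.cases with
    | zero => simp [hi, Val.ofNat]
    | succ i =>
      simp only [hi, Fin.val_succ, Val.ofNat, reduceCtorEq, if_false]
      exact h x i (by simp [hi, Val.ofNat, Val.tl])

/-- A function that depends on a column is polynomial if it is so for every fixed column. -/
theorem PolyFun.fin_cases {n : ℕ} {f : Fin n → γ → β} {g : γ → Fin n} (hg : PolyFun D g)
    (hf : ∀ i, PolyFun D (f i)) : PolyFun D fun c => f (g c) c := by
  obtain ⟨G, hG, hg⟩ := hg
  choose F hF hf using hf
  obtain ⟨H, hH, h⟩ := hG.ofNat_cases hF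
  exact ⟨H, hH, fun c => by rw [h _ (g c) (hg c), hf]⟩

theorem PolyPred.fin_cases {n : ℕ} {p : Fin n → γ → Prop} {g : γ → Fin n} (hg : PolyFun D g)
    (hp : ∀ i, PolyPred D (p i)) : PolyPred D fun c => p (g c) c :=
  PolyFun.fin_cases (f := fun i c => decide (p i c)) hg hp

theorem PolyFun.sym2_cases {n : ℕ} {f : Sym2 (Fin n) → γ → β} {g : γ → Sym2 (Fin n)}
    (hg : PolyFun D g) (hf : ∀ p, PolyFun D (f p)) : PolyFun D fun c => f (g c) c := by
  have h1 : PolyFun D fun c => (g c).inf := by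
    obtain ⟨G, hG, hg⟩ := hg
    exact ⟨_, hG.hd, fun c => by rw [hg]; rfl⟩
  have h2 : PolyFun D fun c => (g c).sup := by
    obtain ⟨G, hG, hg⟩ := hg
    exact ⟨_, hG.tl, fun c => by rw [hg]; rfl⟩
  refine PolyFun.congr (f := fun c => f s((g c).inf, (g c).sup) c)
    (.fin_cases (f := fun i c => f s(i, (g c).sup) c) h1 fun i =>
      .fin_cases (f := fun j c => f s(i, j) c) h2 fun j => hf _) fun c => ?_
  congr 1
  induction g c with
  | h i j => rcases le_total i j with h | h <;> simp [h, Sym2.eq_swap]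

theorem PolyPred.sym2_cases {n : ℕ} {p : Sym2 (Fin n) → γ → Prop} {g : γ → Sym2 (Fin n)}
    (hg : PolyFun D g) (hp : ∀ i, PolyPred D (p i)) : PolyPred D fun c => p (g c) c :=
  PolyFun.sym2_cases (f := fun i c => decide (p i c)) hg hp

/-- Codes of atoms are recognized by an equality test of a value with itself. -/
theorem Val.atomEq_self_atom (a : D) : (Val.atom a).atomEq (.atom a) ≠ .nil := by
  simp [Val.atomEq]

theorem PolyFun.option_cases {f : Option D → γ → β} {g : γ → Option D} (hg : PolyFun D g)
    (h0 : PolyFun D (f none)) (h1 : PolyFun D fun q : D × γ => f (some q.1) q.2) :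
    PolyFun D fun c => f (g c) c := by
  obtain ⟨G, hG, hg⟩ := hg
  obtain ⟨F, hF, h0⟩ := h0
  obtain ⟨H, hH, h1⟩ := h1
  refine ⟨_, (hG.atomEq hG).ite (hH.comp (hG.cons .id)) hF, fun c => ?_⟩
  dsimp only
  rw [hg]
  cases g c with
  | none => exact (if_pos rfl).trans (h0 c)
  | some a => exact (if_neg (Val.atomEq_self_atom a)).trans (h1 (a, c))

theorem PolyPred.option_cases {p : Option D → γ → Prop} {g : γ → Option D} (hg : PolyFun D g)
    (h0 : PolyPred D (p none)) (h1 : PolyPred D fun q : D × γ => p (some q.1) q.2) :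
    PolyPred D fun c => p (g c) c :=
  PolyFun.option_cases (f := fun i c => decide (p i c)) hg h0 h1

theorem Val.atomEq_self_ofNat (k : ℕ) : (Val.ofNat k : Val D).atomEq (.ofNat k) = .nil := by
  cases k <;> rfl

theorem PolyFun.sum_cases {n : ℕ} {f : D ⊕ Fin n → γ → β} {g : γ → D ⊕ Fin n} (hg : PolyFun D g)
    (h0 : PolyFun D fun q : D × γ => f (.inl q.1) q.2) (h1 : ∀ i, PolyFun D (f (.inr i))) :
    PolyFun D fun c => f (g c) c := by
  obtain ⟨G, hG, hg⟩ := hg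
  obtain ⟨H, hH, h0⟩ := h0
  choose F hF h1 using h1
  obtain ⟨K, hK, h⟩ := hG.ofNat_cases hF
  refine ⟨_, (hG.atomEq hG).ite (hH.comp (hG.cons .id)) hK, fun c => ?_⟩
  dsimp only
  rw [hg]
  cases e : g c with
  | inl a => exact (if_neg (Val.atomEq_self_atom a)).trans (h0 (a, c))
  | inr i =>
    refine (if_pos (Val.atomEq_self_ofNat _)).trans ?_
    rw [h _ i (by rw [hg, e]; rfl), h1]

theorem PolyPred.sum_cases {n : ℕ} {p : D ⊕ Fin n → γ → Prop} {g : γ → D ⊕ Fin n}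
    (hg : PolyFun D g) (h0 : PolyPred D fun q : D × γ => p (.inl q.1) q.2)
    (h1 : ∀ i, PolyPred D (p (.inr i))) : PolyPred D fun c => p (g c) c :=
  PolyFun.sum_cases (f := fun i c => decide (p i c)) hg h0 h1

theorem PolyFun.lit_cases {n : ℕ} {f : Lit n D → γ → β} {g : γ → Lit n D} (hg : PolyFun D g)
    (h0 : ∀ p, PolyFun D (f (.eq p))) (h1 : ∀ p, PolyFun D (f (.ne p)))
    (h2 : ∀ i, PolyFun D fun q : D × γ => f (.neConst i q.1) q.2) :
    PolyFun D fun c => f (g c) c := by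
  obtain ⟨G, hG, hg⟩ := hg
  obtain ⟨F0, hF0, h0⟩ := PolyFun.sym2_cases (f := fun p (q : Sym2 (Fin n) × γ) => f (.eq p) q.2)
    (PolyFun.id.fst (D := D)) fun p => (h0 p).comp PolyFun.id.snd
  obtain ⟨F1, hF1, h1⟩ := PolyFun.sym2_cases (f := fun p (q : Sym2 (Fin n) × γ) => f (.ne p) q.2)
    (PolyFun.id.fst (D := D)) fun p => (h1 p).comp PolyFun.id.snd
  obtain ⟨F2, hF2, h2⟩ := PolyFun.fin_cases
    (f := fun i (q : (Fin n × D) × γ) => f (.neConst i q.1.2) q.2)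
    (PolyFun.id.fst.fst (D := D)) fun i => (h2 i).comp (PolyFun.id.fst.snd.pair PolyFun.id.snd)
  refine ⟨_, hG.hd.ite (hG.hd.tl.ite (hF2.comp (hG.tl.cons .id)) (hF1.comp (hG.tl.cons .id)))
    (hF0.comp (hG.tl.cons .id)), fun c => ?_⟩
  dsimp only
  rw [hg]
  cases g c with
  | eq p => exact (if_pos rfl).trans (h0 (p, c))
  | ne p => exact (if_neg nofun).trans ((if_pos rfl).trans (h1 (p, c)))
  | neConst i a => exact (if_neg nofun).trans ((if_neg nofun).trans (h2 ((i, a), c)))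

theorem PolyPred.lit_cases {n : ℕ} {p : Lit n D → γ → Prop} {g : γ → Lit n D} (hg : PolyFun D g)
    (h0 : ∀ q, PolyPred D (p (.eq q))) (h1 : ∀ q, PolyPred D (p (.ne q)))
    (h2 : ∀ i, PolyPred D fun q : D × γ => p (.neConst i q.1) q.2) :
    PolyPred D fun c => p (g c) c :=
  PolyFun.lit_cases (f := fun i c => decide (p i c)) hg h0 h1 h2

/-! ### Constants and constructors -/

theorem PolyTime.ofNat (k : ℕ) : PolyTime fun _ : Val D => .ofNat k := by
  induction k with
  | zero => exact .nil
  | succ k ih => exact PolyTime.nil.cons ih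

theorem PolyFun.fin {n : ℕ} (i : Fin n) : PolyFun D fun _ : γ => i :=
  ⟨_, .ofNat i, fun _ => rfl⟩

theorem PolyFun.sym2 {n : ℕ} (p : Sym2 (Fin n)) : PolyFun D fun _ : γ => p :=
  ⟨_, (PolyTime.ofNat _).cons (.ofNat _), fun _ => rfl⟩

theorem PolyFun.none : PolyFun D fun _ : γ => (Option.none : Option D) := ⟨_, .nil, fun _ => rfl⟩

theorem PolyFun.some {f : γ → D} (hf : PolyFun D f) : PolyFun D fun c => Option.some (f c) := hf

theorem PolyFun.inl {n : ℕ} {f : γ → D} (hf : PolyFun D f) :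
    PolyFun D fun c => (Sum.inl (f c) : D ⊕ Fin n) := hf

theorem PolyFun.inr {n : ℕ} {f : γ → Fin n} (hf : PolyFun D f) :
    PolyFun D fun c => (Sum.inr (f c) : D ⊕ Fin n) := hf

theorem PolyFun.lit_eq {n : ℕ} {f : γ → Sym2 (Fin n)} (hf : PolyFun D f) :
    PolyFun D fun c => (Lit.eq (f c) : Lit n D) := by
  obtain ⟨F, hF, hf⟩ := hf
  exact ⟨_, (PolyTime.ofNat 0).cons hF, fun c => by rw [hf]; rfl⟩

theorem PolyFun.lit_ne {n : ℕ} {f : γ → Sym2 (Fin n)} (hf : PolyFun D f) :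
    PolyFun D fun c => (Lit.ne (f c) : Lit n D) := by
  obtain ⟨F, hF, hf⟩ := hf
  exact ⟨_, (PolyTime.ofNat 1).cons hF, fun c => by rw [hf]; rfl⟩

theorem PolyFun.lit_neConst {n : ℕ} {f : γ → Fin n} {g : γ → D} (hf : PolyFun D f)
    (hg : PolyFun D g) : PolyFun D fun c => Lit.neConst (f c) (g c) := by
  obtain ⟨F, hF, hf⟩ := hf
  obtain ⟨G, hG, hg⟩ := hg
  exact ⟨_, (PolyTime.ofNat 2).cons (hF.cons hG), fun c => by rw [hf, hg]; rfl⟩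

theorem PolyFun.apply {k : ℕ} {f : γ → Fin k → α} (hf : PolyFun D f) (i : Fin k) :
    PolyFun D fun c => f c i := by
  obtain ⟨F, hF, hf⟩ := hf
  have key : ∀ (k : ℕ) (i : Fin k), ∃ G : Val D → Val D, PolyTime G ∧
      ∀ f : Fin k → α, G (code f) = code (f i) := by
    intro k
    induction k with
    | zero => exact fun i => i.elim0
    | succ k ih =>
      intro i
      cases i using Fin.cases with
      | zero => exact ⟨_, .val_hd, fun f => by simp [code, Val.ofList, Val.hd]⟩
      | succ i =>
        obtain ⟨G, hG, h⟩ := ih i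
        refine ⟨_, hG.comp .val_tl, fun f => ?_⟩
        rw [← h fun i => f i.succ]
        simp [code, Val.ofList, Val.tl]
  obtain ⟨G, hG, h⟩ := key k i
  exact ⟨_, hG.comp hF, fun c => by rw [hf, h]⟩

theorem PolyFun.pi {k : ℕ} {f : γ → Fin k → α} (hf : ∀ i, PolyFun D fun c => f c i) :
    PolyFun D f := by
  induction k with
  | zero => exact ⟨_, .nil, fun c => by simp [code, Val.ofList]⟩
  | succ k ih =>
    obtain ⟨F, hF, h⟩ := ih (f := fun c i => f c i.succ) fun i => hf i.succ
    obtain ⟨G, hG, h'⟩ := hf 0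
    exact ⟨_, hG.cons hF, fun c => by rw [h, h']; simp [code, Val.ofList]⟩

theorem PolyFun.nil : PolyFun D fun _ : γ => ([] : List α) := ⟨_, .nil, fun _ => rfl⟩

theorem PolyFun.cons {f : γ → α} {g : γ → List α} (hf : PolyFun D f) (hg : PolyFun D g) :
    PolyFun D fun c => f c :: g c := by
  obtain ⟨F, hF, hf⟩ := hf
  obtain ⟨G, hG, hg⟩ := hg
  exact ⟨_, hF.cons hG, fun c => by rw [hf, hg]; rfl⟩

theorem PolyFun.const_list {l : List α} (h : ∀ a ∈ l, PolyFun D fun _ : γ => a) :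
    PolyFun D fun _ : γ => l := by
  induction l with
  | nil => exact .nil
  | cons a l ih => exact (h a (by simp)).cons (ih fun b hb => h b (by simp [hb]))

theorem PolyPred.eq_nil {f : γ → List α} (hf : PolyFun D f) : PolyPred D fun c => f c = [] := by
  obtain ⟨F, hF, hf⟩ := hf
  refine ⟨_, hF.ite .nil (PolyTime.nil.cons .nil), fun c => ?_⟩
  have h : (code (f c) : Val D) = .nil ↔ f c = [] := by
    cases f c <;> simp [code, Val.ofList]
  rw [← hf] at h
  by_cases h' : f c = [] <;> simp [h, h', code]

theorem PolyFun.head? {f : γ → List D} (hf : PolyFun D f) : PolyFun D fun c => (f c).head? := by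
  obtain ⟨F, hF, hf⟩ := hf
  refine ⟨_, hF.hd, fun c => ?_⟩
  dsimp only
  rw [hf]
  cases f c <;> rfl

/-! ### Loops over lists -/

/-- The concatenation of the lists `g a l'`, for the splittings of `l` as `… ++ a :: l'`. -/
def flatMapTails (l : List α) (g : α → List α → List β) : List β :=
  match l with
  | [] => []
  | a :: l => g a l ++ flatMapTails l g

/-- The type `γ` is the context of the loop, and its variables are added to it as the first
component of a pair, so that `.fst .id` below stands for the innermost bound variable. -/
theorem PolyFun.flatMapTails {f : γ → List α} {g : γ → α → List α → List β} (hf : PolyFun D f)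
    (hg : PolyFun D fun q : (α × List α) × γ => g q.2 q.1.1 q.1.2) :
    PolyFun D fun c => SCA.flatMapTails (f c) (g c) := by
  obtain ⟨F, hF, hf⟩ := hf
  obtain ⟨G, hG, hg⟩ := hg
  refine ⟨_, hG.val_tails.comp (hF.cons .id), fun c => ?_⟩
  rw [hf]
  simp only [Val.hd, Val.tl]
  change _ = Val.ofList _
  congr 1
  induction f c with
  | nil => rfl
  | cons a l ih =>
    have e : (G (.cons (code (a :: l)) (code c))).toList = (g c a l).map code := by
      rw [← Val.toList_ofList ((g c a l).map code)]
      exact congrArg _ (hg ((a, l), c))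
    have e2 : (code (a :: l) : Val D).tails = code (a :: l) :: (code l : Val D).tails := rfl
    rw [e2, List.flatMap_cons, ih, e]
    simp [SCA.flatMapTails]

theorem PolyFun.flatMap {f : γ → List α} {g : γ → α → List β} (hf : PolyFun D f)
    (hg : PolyFun D fun q : α × γ => g q.2 q.1) : PolyFun D fun c => (f c).flatMap (g c) := by
  refine (PolyFun.flatMapTails (g := fun c a _ => g c a) hf
    (hg.comp (f := fun q : (α × List α) × γ => (q.1.1, q.2)) (id.fst.fst.pair id.snd))).congr
    fun c => ?_
  induction f c with
  | nil => rfl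
  | cons a l ih => simp [SCA.flatMapTails, ih]

theorem PolyFun.map {f : γ → List α} {g : γ → α → β} (hf : PolyFun D f)
    (hg : PolyFun D fun q : α × γ => g q.2 q.1) : PolyFun D fun c => (f c).map (g c) :=
  (hf.flatMap (g := fun c a => [g c a]) (hg.cons .nil)).congr fun c => by
    induction f c <;> simp_all

theorem PolyFun.filter {f : γ → List α} {p : γ → α → Prop} [∀ c a, Decidable (p c a)]
    (hf : PolyFun D f) (hp : PolyPred D fun q : α × γ => p q.2 q.1) :
    PolyFun D fun c => (f c).filter fun a => p c a :=
  (hf.flatMap (g := fun c a => if p c a then [a] else []) (.ite hp (id.fst.cons .nil) .nil)).congr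
    fun c => by
      induction f c with
      | nil => rfl
      | cons a l ih => by_cases h : p c a <;> simp [ih, h]

theorem PolyFun.append {f g : γ → List α} (hf : PolyFun D f) (hg : PolyFun D g) :
    PolyFun D fun c => f c ++ g c :=
  ((hf.cons (hg.cons .nil)).flatMap (g := fun _ l => l) id.fst).congr fun c => by simp

theorem PolyPred.exists_mem {f : γ → List α} {p : γ → α → Prop} (hf : PolyFun D f)
    (hp : PolyPred D fun q : α × γ => p q.2 q.1) : PolyPred D fun c => ∃ a ∈ f c, p c a :=
  (PolyPred.eq_nil (hf.filter (p := p) hp)).not.congr fun c => by simp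

theorem PolyPred.forall_mem {f : γ → List α} {p : γ → α → Prop} (hf : PolyFun D f)
    (hp : PolyPred D fun q : α × γ => p q.2 q.1) : PolyPred D fun c => ∀ a ∈ f c, p c a :=
  (PolyPred.exists_mem hf (p := fun c a => ¬ p c a) hp.not).not.congr fun c => by simp

/-! ### Tests for equality -/

theorem PolyPred.eq_atom {f g : γ → D} (hf : PolyFun D f) (hg : PolyFun D g) :
    PolyPred D fun c => f c = g c := by
  obtain ⟨F, hF, hf⟩ := hf
  obtain ⟨G, hG, hg⟩ := hg
  refine ⟨_, hF.atomEq hG, fun c => ?_⟩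
  rw [hf, hg]
  by_cases h : f c = g c <;> simp [code, h, Val.atomEq]

theorem PolyPred.eq_sym2 {n : ℕ} {f g : γ → Sym2 (Fin n)} (hf : PolyFun D f) (hg : PolyFun D g) :
    PolyPred D fun c => f c = g c :=
  .sym2_cases (p := fun i c => i = g c) hf fun i => .sym2_cases (p := fun j _ => i = j) hg fun _ =>
    .const _

theorem PolyPred.eq_option {f g : γ → Option D} (hf : PolyFun D f) (hg : PolyFun D g) :
    PolyPred D fun c => f c = g c := by
  refine .option_cases (p := fun x c => x = g c) hf
    (.option_cases (p := fun x _ => Option.none = x) hg (.const _)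
      ((PolyPred.const False).congr fun c => by simp))
    (.option_cases (p := fun x (c : D × γ) => Option.some c.1 = x) (hg.comp (.snd .id))
      ((PolyPred.const False).congr fun c => by simp) ?_)
  exact (PolyPred.eq_atom PolyFun.id.snd.fst PolyFun.id.fst).congr fun c => by simp

theorem PolyPred.eq_sum {n : ℕ} {f g : γ → D ⊕ Fin n} (hf : PolyFun D f) (hg : PolyFun D g) :
    PolyPred D fun c => f c = g c := by
  refine .sum_cases (p := fun x c => x = g c) hf
    (.sum_cases (p := fun x (c : D × γ) => Sum.inl c.1 = x) (hg.comp (.snd .id)) ?_ fun i =>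
      (PolyPred.const False).congr fun c => by simp)
    fun i => .sum_cases (p := fun x _ => Sum.inr i = x) hg
      ((PolyPred.const False).congr fun c => by simp) fun j => .const _
  exact (PolyPred.eq_atom PolyFun.id.snd.fst PolyFun.id.fst).congr fun c => by simp

theorem PolyPred.eq_lit {n : ℕ} {f g : γ → Lit n D} (hf : PolyFun D f) (hg : PolyFun D g) :
    PolyPred D fun c => f c = g c := by
  refine .lit_cases (p := fun x c => x = g c) hf
    (fun p => .lit_cases (p := fun x _ => Lit.eq p = x) hg (fun _ => .const _) (fun _ => .const _)
      fun i => (PolyPred.const False).congr fun c => by simp)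
    (fun p => .lit_cases (p := fun x _ => Lit.ne p = x) hg (fun _ => .const _) (fun _ => .const _)
      fun i => (PolyPred.const False).congr fun c => by simp)
    fun i => .lit_cases (p := fun x (c : D × γ) => Lit.neConst i c.1 = x) (hg.comp (.snd .id))
      (fun _ => (PolyPred.const False).congr fun c => by simp)
      (fun _ => (PolyPred.const False).congr fun c => by simp) fun j => ?_
  exact ((PolyPred.const (i = j)).and (PolyPred.eq_atom PolyFun.id.snd.fst PolyFun.id.fst)).congr
    fun c => by simp

theorem PolyPred.eq_pi {k : ℕ} {f g : γ → Fin k → Option D} (hf : PolyFun D f) (hg : PolyFun D g) :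
    PolyPred D fun c => f c = g c :=
  (PolyPred.forall_finite fun i => .eq_option (hf.apply i) (hg.apply i)).congr fun _ =>
    funext_iff.symm

theorem PolyPred.mem_lit {n : ℕ} {f : γ → Lit n D} {g : γ → List (Lit n D)} (hf : PolyFun D f)
    (hg : PolyFun D g) : PolyPred D fun c => f c ∈ g c :=
  (PolyPred.exists_mem hg (p := fun c a => a = f c)
    (.eq_lit (.fst .id) (hf.comp (.snd .id)))).congr fun c => by simp

end

/-! ### Deciding implication in finitely many worlds -/

section

variable {n m : ℕ} {D : Type*}

/-- The truth of a literal in a world, i.e. a tuple over `D` and `n` fresh elements. -/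
def Lit.HoldsIn (w : Fin n → D ⊕ Fin n) : Lit n D → Prop
  | .eq p => (p.map w).IsDiag
  | .ne p => ¬ (p.map w).IsDiag
  | .neConst i a => w i ≠ .inl a

/-- The ordinary tuple `v` and the world `w` have the same equalities between columns and between
columns and the constants in `A`. -/
structure SameType (A : Finset D) (v : Fin n → D) (w : Fin n → D ⊕ Fin n) : Prop where
  const_iff : ∀ i, ∀ a ∈ A, v i = a ↔ w i = .inl a
  eq_iff : ∀ i j, v i = v j ↔ w i = w j

/-- Every ordinary tuple has the type of a world: entries outside `A` are replaced by fresh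
elements, equal entries by equal ones. -/
theorem exists_world (A : Finset D) (v : Fin n → D) :
    ∃ w : Fin n → D ⊕ Fin n, (∀ i a, w i = .inl a → a ∈ A) ∧ SameType A v w := by
  have key : ∀ i : Fin n, ∃ j, v j = v i := fun i => ⟨i, rfl⟩
  -- `r i` is a column with the same entry as `i`, the same one for all such `i`; it names the fresh
  -- element.
  let r : Fin n → Fin n := fun i => haveI : Nonempty (Fin n) := ⟨i⟩
    Classical.epsilon fun j => v j = v i
  have hr : ∀ i, v (r i) = v i := fun i =>
    haveI : Nonempty (Fin n) := ⟨i⟩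
    Classical.epsilon_spec (p := fun j => v j = v i) ⟨i, rfl⟩
  have hr' : ∀ i j, v i = v j → r i = r j := fun i j h => by simp only [r, h]
  refine ⟨fun i => if v i ∈ A then .inl (v i) else .inr (r i), fun i a h => ?_, fun i a ha => ?_,
    fun i j => ?_⟩
  · by_cases hi : v i ∈ A <;> simp [hi] at h
    exact h ▸ hi
  · by_cases hi : v i ∈ A
    · simp [hi]
    · simp only [hi, if_false, reduceCtorEq, iff_false]
      exact fun h => hi (h ▸ ha)
  · by_cases hi : v i ∈ A <;> by_cases hj : v j ∈ A <;> simp only [hi, hj, if_true, if_false,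
      Sum.inl.injEq, Sum.inr.injEq, reduceCtorEq, iff_false]
    · exact fun h => hj (h ▸ hi)
    · exact fun h => hi (h ▸ hj)
    · exact ⟨hr' i j, fun h => by rw [← hr i, h, hr j]⟩

/-- Every world over `A` has the type of an ordinary tuple, since the infinite domain has enough
elements outside `A` to stand for the fresh ones. They can be chosen outside a given finite set `B`
as well. -/
theorem exists_tuple [Infinite D] (A B : Finset D) {w : Fin n → D ⊕ Fin n}
    (hw : ∀ i a, w i = .inl a → a ∈ A) :
    ∃ v : Fin n → D, SameType A v w ∧ ∀ i, v i ∈ A ∨ v i ∉ B := by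
  have hinf : ((A ∪ B : Finset D) : Set D)ᶜ.Infinite := (A ∪ B).finite_toSet.infinite_compl
  let e := hinf.natEmbedding
  have he : ∀ k, (e k : D) ∉ A ∧ (e k : D) ∉ B := fun k => by
    have := (e k).2
    simpa using this
  have hinj : ∀ k l, (e k : D) = e l → k = l := fun k l h => e.injective (Subtype.ext h)
  refine ⟨fun i => Sum.elim (fun a => a) (fun k : Fin n => (e k : D)) (w i), ⟨fun i a ha => ?_,
    fun i j => ?_⟩, fun i => ?_⟩
  · cases h : w i with
    | inl b => simp
    | inr k =>
      simp only [Sum.elim_inr, reduceCtorEq, iff_false]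
      exact fun h => (he _).1 (h ▸ ha)
  · cases h : w i with
    | inl b =>
      cases h' : w j with
      | inl c => simp
      | inr k =>
        simp only [Sum.elim_inr, Sum.elim_inl, reduceCtorEq, iff_false]
        exact fun e => (he _).1 (e ▸ hw i b h)
    | inr k =>
      cases h' : w j with
      | inl c =>
        simp only [Sum.elim_inr, Sum.elim_inl, reduceCtorEq, iff_false]
        exact fun e => (he _).1 (e ▸ hw j c h')
      | inr l =>
        simp only [Sum.elim_inr, Sum.inr.injEq]
        exact ⟨fun h => Fin.ext (hinj _ _ h), fun h => by rw [h]⟩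
  · cases h : w i with
    | inl b => exact .inl (by simpa [h] using hw i b h)
    | inr k => exact .inr (by simpa [h] using (he k).2)

theorem SameType.lit_iff {A : Finset D} {v : Fin n → D} {w : Fin n → D ⊕ Fin n}
    (h : SameType A v w) {l : Lit n D} (hl : l.consts ⊆ A) : l.Holds v ↔ l.HoldsIn w := by
  cases l with
  | eq p => induction p with | h i j => simpa [Lit.Holds, Lit.HoldsIn] using h.eq_iff i j
  | ne p => induction p with | h i j => simpa [Lit.Holds, Lit.HoldsIn] using (h.eq_iff i j).not
  | neConst i a => exact (h.const_iff i a (hl (by simp [Lit.consts]))).not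

/-! ### Star-tuples and star-cylinders as lists -/

/-- Star-tuples whose condition is listed. -/
abbrev ListTuple (n : ℕ) (D : Type*) := (Fin n → Option D) × List (Lit n D)

/-- The star-tuple that is listed. -/
def toTuple (t : ListTuple n D) : StarTuple n D := ⟨t.1, t.2.toFinset⟩

/-- The star-cylinder that is listed. -/
def toCyl (X : List (ListTuple n D)) : StarCyl n D := (X.map toTuple).toFinset

theorem mem_toCyl {X : List (ListTuple n D)} {t : StarTuple n D} :
    t ∈ toCyl X ↔ ∃ x ∈ X, toTuple x = t := by
  simp [toCyl]

theorem toCyl_append (X Y : List (ListTuple n D)) : toCyl (X ++ Y) = toCyl X ∪ toCyl Y := by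
  ext t
  simp [mem_toCyl, or_and_right, exists_or]

/-- The constants in a literal. -/
def Lit.constList : Lit n D → List D
  | .neConst _ a => [a]
  | _ => []

/-- The constants in a listed star-tuple. -/
def constList (t : ListTuple n D) : List D :=
  ((List.finRange n).flatMap fun i => (t.1 i).toList) ++ t.2.flatMap Lit.constList

theorem Lit.mem_constList {l : Lit n D} {a : D} : a ∈ l.constList ↔ a ∈ l.consts := by
  cases l <;> simp [Lit.constList, Lit.consts]

theorem mem_constList {t : ListTuple n D} {a : D} :
    a ∈ constList t ↔ a ∈ (toTuple t).consts := by
  simp [constList, StarTuple.consts, toTuple, Lit.mem_constList]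

theorem toFinset_constList (t : ListTuple n D) : (constList t).toFinset = (toTuple t).consts := by
  ext a
  simp [mem_constList]

/-- All tuples of length `k` with entries in `U`; for fixed `k`, this list has polynomial size. -/
def piList {α : Type*} (U : List α) : (k : ℕ) → List (Fin k → α)
  | 0 => [Fin.elim0]
  | k + 1 => U.flatMap fun a => (piList U k).map fun f => Fin.cons a f

theorem mem_piList {α : Type*} {U : List α} {k : ℕ} {f : Fin k → α} :
    f ∈ piList U k ↔ ∀ i, f i ∈ U := by
  induction k with
  | zero => simp [piList, Subsingleton.elim f Fin.elim0]
  | succ k ih =>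
    simp only [piList, List.mem_flatMap, List.mem_map, ih]
    constructor
    · rintro ⟨a, ha, g, hg, rfl⟩ i
      cases i using Fin.cases <;> simp [ha, hg]
    · exact fun h => ⟨f 0, h 0, fun i => f i.succ, fun i => h i.succ, Fin.cons_self_tail f⟩

/-- The truth of a listed star-tuple in a world. -/
def HoldsIn (t : ListTuple n D) (w : Fin n → D ⊕ Fin n) : Prop :=
  (∀ i a, t.1 i = some a → w i = .inl a) ∧ ∀ l ∈ t.2, l.HoldsIn w

/-- The worlds with constants in `t` in which `t` is true. -/
def models (t : ListTuple n D) : List (Fin n → D ⊕ Fin n) :=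
  (piList ((constList t).map .inl ++ (List.finRange n).map .inr) n).filter fun w => HoldsIn t w

theorem mem_models {t : ListTuple n D} {w : Fin n → D ⊕ Fin n} :
    w ∈ models t ↔ (∀ i a, w i = .inl a → a ∈ (toTuple t).consts) ∧ HoldsIn t w := by
  simp only [models, List.mem_filter, mem_piList, List.mem_append, List.mem_map, decide_eq_true_eq,
    mem_constList, List.mem_finRange, true_and]
  refine and_congr_left fun _ => forall_congr' fun i => ⟨?_, fun h => ?_⟩
  · rintro (⟨a, ha, e⟩ | ⟨k, e⟩) b hb
    · rw [← e] at hb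
      rwa [← Sum.inl.inj hb]
    · rw [← e] at hb
      cases hb
  · cases e : w i with
    | inl a => exact .inl ⟨a, h a e, rfl⟩
    | inr k => exact .inr ⟨k, rfl⟩

theorem SameType.tuple_iff {t : ListTuple n D} {v : Fin n → D} {w : Fin n → D ⊕ Fin n}
    (h : SameType (toTuple t).consts v w) : (toTuple t).Holds v ↔ HoldsIn t w := by
  refine and_congr (forall_congr' fun i => forall_congr' fun a => forall_congr' fun e =>
    h.const_iff i a ?_) ?_
  · simp only [StarTuple.consts, Finset.mem_union, Finset.mem_biUnion]
    exact .inl ⟨i, by simp [e]⟩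
  · simp only [toTuple, List.mem_toFinset]
    refine forall_congr' fun l => forall_congr' fun hl => h.lit_iff fun a ha => ?_
    simp only [StarTuple.consts, Finset.mem_union, Finset.mem_biUnion]
    exact .inr ⟨l, by simpa [toTuple] using hl, ha⟩

/-- It suffices to look at the finitely many models in order to know what is true of all ordinary
tuples that `t` represents; only `n` elements other than the constants can be distinguished. -/
theorem forall_holds_iff [Infinite D] {t : ListTuple n D} {P : (Fin n → D) → Prop}
    {Q : (Fin n → D ⊕ Fin n) → Prop} (B : Finset D)
    (h : ∀ v w, SameType (toTuple t).consts v w → (∀ i, v i ∈ (toTuple t).consts ∨ v i ∉ B) →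
      (P v → Q w))
    (h' : ∀ v w, SameType (toTuple t).consts v w → (Q w → P v)) :
    (∀ v, (toTuple t).Holds v → P v) ↔ ∀ w ∈ models t, Q w := by
  constructor
  · intro H w hw
    rw [mem_models] at hw
    obtain ⟨v, hv, hB⟩ := exists_tuple _ B hw.1
    exact h v w hv hB (H v (hv.tuple_iff.2 hw.2))
  · intro H v hv
    obtain ⟨w, hw, hvw⟩ := exists_world (toTuple t).consts v
    exact h' v w hvw (H w (mem_models.2 ⟨hw, hvw.tuple_iff.1 hv⟩))

theorem satisfiable_iff [Infinite D] {t : ListTuple n D} :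
    (toTuple t).Satisfiable ↔ models t ≠ [] := by
  have := forall_holds_iff (t := t) (P := fun _ => False) (Q := fun _ => False) ∅
    (fun _ _ _ _ => id) fun _ _ _ => id
  rw [StarTuple.Satisfiable, ← not_iff_not, not_exists, not_not, List.eq_nil_iff_forall_not_mem]
  exact this

theorem entails_iff [Infinite D] {t : ListTuple n D} {l : Lit n D}
    (hl : l.consts ⊆ (toTuple t).consts) :
    (toTuple t).Entails l ↔ ∀ w ∈ models t, l.HoldsIn w :=
  forall_holds_iff ∅ (fun _ _ h _ => (h.lit_iff hl).1) fun _ _ h => (h.lit_iff hl).2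

/-- A forced value is a constant of the tuple: a fresh element could be realized differently. -/
theorem forall_eq_iff [Infinite D] {t : ListTuple n D} (ht : models t ≠ []) {i : Fin n} {a : D} :
    (∀ v, (toTuple t).Holds v → v i = a) ↔
      a ∈ constList t ∧ ∀ w ∈ models t, w i = .inl a := by
  rw [forall_holds_iff {a} (Q := fun w => a ∈ constList t ∧ w i = .inl a)]
  · constructor
    · intro h
      obtain ⟨w, hw⟩ := List.exists_mem_of_ne_nil _ ht
      exact ⟨(h w hw).1, fun w hw => (h w hw).2⟩
    · exact fun h w hw => ⟨h.1, h.2 w hw⟩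
  · rintro v w h hB rfl
    have := (hB i).resolve_right (by simp)
    exact ⟨mem_constList.2 this, (h.const_iff i _ this).1 rfl⟩
  · exact fun v w h hw => (h.const_iff i a (mem_constList.1 hw.1)).2 hw.2

/-- The entries of the normal form: the first constant that a column has in all models. -/
def forcedList (t : ListTuple n D) (i : Fin n) : Option D :=
  ((constList t).filter fun a => ∀ w ∈ models t, w i = .inl a).head?

theorem forced_toTuple [Infinite D] {t : ListTuple n D} (ht : models t ≠ []) (i : Fin n) :
    (toTuple t).forced i = forcedList t i := by
  have key : ∀ a, a ∈ (constList t).filter (fun a => ∀ w ∈ models t, w i = .inl a) ↔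
      ∀ v, (toTuple t).Holds v → v i = a := fun a => by simp [forall_eq_iff ht]
  unfold StarTuple.forced forcedList
  cases h : (constList t).filter fun a => ∀ w ∈ models t, w i = .inl a with
  | nil =>
    rw [dif_neg]
    · rfl
    · rintro ⟨a, ha⟩
      have := (key a).2 ha
      simp [h] at this
  | cons b l =>
    have hb := (key b).1 (by simp [h])
    have he : ∃ a, ∀ v, (toTuple t).Holds v → v i = a := ⟨b, hb⟩
    rw [dif_pos he]
    obtain ⟨v, hv⟩ := satisfiable_iff.2 ht
    simp [← he.choose_spec v hv, hb v hv]

variable (n) in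
/-- The pairs of different columns. -/
def pairList : List (Sym2 (Fin n)) := (Finset.univ.filter fun p : Sym2 (Fin n) => ¬ p.IsDiag).toList

theorem mem_pairList {p : Sym2 (Fin n)} : p ∈ pairList n ↔ ¬ p.IsDiag := by simp [pairList]

variable (n) in
/-- The literals with constants in `A`. -/
def litList (A : List D) : List (Lit n D) :=
  (pairList n).map .eq ++ (pairList n).map .ne ++
    (List.finRange n).flatMap fun i => A.map fun a => .neConst i a

theorem mem_litList {A : List D} {l : Lit n D} : l ∈ litList n A ↔ l ∈ litsOver n A.toFinset := by
  simp [litList, litsOver, mem_pairList]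

/-- The normal form, as a list with at most one element. -/
def normalizeList (t : ListTuple n D) : List (ListTuple n D) :=
  if models t = [] then [] else
    [(forcedList t, (litList n (constList t)).filter fun l => (∀ w ∈ models t, l.HoldsIn w) ∧
      ∀ i, l.Mentions i → forcedList t i = none)]

theorem mem_litsOver_consts {A : Finset D} {l : Lit n D} (h : l ∈ litsOver n A) :
    l.consts ⊆ A := by
  cases l with
  | eq p => simp [Lit.consts]
  | ne p => simp [Lit.consts]
  | neConst i a => simpa [Lit.consts, litsOver] using h

theorem toCyl_normalizeList [Infinite D] (t : ListTuple n D) :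
    toCyl (normalizeList t) = (toTuple t).normalize.toFinset := by
  unfold normalizeList StarTuple.normalize
  by_cases h : models t = []
  · rw [if_pos h, if_neg (by rw [satisfiable_iff]; exact not_not.2 h)]
    simp [toCyl]
  · rw [if_neg h, if_pos (satisfiable_iff.2 h)]
    simp only [toCyl, List.map_cons, List.map_nil, List.toFinset_cons, List.toFinset_nil,
      insert_empty_eq, Option.toFinset_some, Finset.singleton_inj]
    unfold toTuple
    congr 1
    · exact (funext (forced_toTuple h)).symm
    · ext l
      have hf : (toTuple t).forced = forcedList t := funext (forced_toTuple h)
      simp only [List.mem_toFinset, List.mem_filter, mem_litList, toFinset_constList,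
        Finset.mem_filter, decide_eq_true_eq]
      refine and_congr_right fun hl => ?_
      change _ ↔ (toTuple t).Entails l ∧ ∀ i, l.Mentions i → (toTuple t).forced i = none
      rw [entails_iff (mem_litsOver_consts hl), hf]

/-- The meet, as a list with at most one element. -/
def meetList (t u : ListTuple n D) : List (ListTuple n D) :=
  if ∃ j, t.1 j ≠ none ∧ u.1 j ≠ none ∧ t.1 j ≠ u.1 j then []
  else normalizeList (fun i => (t.1 i).or (u.1 i), t.2 ++ u.2)

theorem toCyl_meetList [Infinite D] (t u : ListTuple n D) :
    toCyl (meetList t u) = ((toTuple t).meet (toTuple u)).toFinset := by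
  have h : (∃ j, t.1 j ≠ none ∧ u.1 j ≠ none ∧ t.1 j ≠ u.1 j) ↔
      ∃ j a b, t.1 j = some a ∧ u.1 j = some b ∧ a ≠ b := by
    refine exists_congr fun j => ?_
    cases t.1 j <;> cases u.1 j <;> simp
  unfold meetList StarTuple.meet
  by_cases hc : ∃ j a b, t.1 j = some a ∧ u.1 j = some b ∧ a ≠ b
  · rw [if_pos (h.2 hc), if_pos (by exact hc)]
    simp [toCyl]
  · rw [if_neg (mt h.1 hc), if_neg (by exact hc), toCyl_normalizeList]
    simp [toTuple]

/-- Star-intersection. -/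
def interList (X Y : List (ListTuple n D)) : List (ListTuple n D) :=
  X.flatMap fun t => Y.flatMap fun u => meetList t u

theorem toCyl_interList [Infinite D] (X Y : List (ListTuple n D)) :
    toCyl (interList X Y) = inter (toCyl X) (toCyl Y) := by
  ext r
  have h : ∀ t u, (∃ x ∈ meetList t u, toTuple x = r) ↔ (toTuple t).meet (toTuple u) = some r :=
    fun t u => by rw [← mem_toCyl, toCyl_meetList]; simp
  simp only [mem_toCyl, interList, inter, List.mem_flatMap, Finset.mem_biUnion, Finset.mem_product,
    Option.mem_toFinset, Option.mem_def]
  constructor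
  · rintro ⟨x, ⟨t, ht, u, hu, hx⟩, rfl⟩
    exact ⟨(_, _), ⟨⟨t, ht, rfl⟩, u, hu, rfl⟩, (h t u).1 ⟨x, hx, rfl⟩⟩
  · rintro ⟨_, ⟨⟨t, ht, e⟩, u, hu, e'⟩, hr⟩
    rw [← e, ← e'] at hr
    obtain ⟨x, hx, rfl⟩ := (h t u).2 hr
    exact ⟨x, ⟨t, ht, u, hu, hx⟩, rfl⟩

/-- Outer cylindrification. -/
def outerList (i : Fin n) (X : List (ListTuple n D)) : List (ListTuple n D) :=
  X.map fun t => (fun j => if j = i then none else t.1 j, t.2.filter fun l => ¬ l.Mentions i)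

theorem toCyl_outerList (i : Fin n) (X : List (ListTuple n D)) :
    toCyl (outerList i X) = outer i (toCyl X) := by
  have h : ∀ t : ListTuple n D, toTuple (fun j => if j = i then none else t.1 j,
      t.2.filter fun l => ¬ l.Mentions i) = (toTuple t).outer i := fun t => by
    simp only [toTuple, StarTuple.outer, List.toFinset_filter, decide_eq_true_eq]
    congr 1
    ext j
    by_cases hj : j = i
    · subst hj; simp
    · simp [hj]
  ext r
  simp only [mem_toCyl, outerList, outer, List.mem_map, Finset.mem_image]
  constructor
  · rintro ⟨_, ⟨t, ht, rfl⟩, rfl⟩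
    exact ⟨_, ⟨t, ht, rfl⟩, (h t).symm⟩
  · rintro ⟨_, ⟨t, ht, rfl⟩, rfl⟩
    exact ⟨_, ⟨t, ht, rfl⟩, h t⟩

theorem toCyl_filter (X : List (ListTuple n D)) {q : ListTuple n D → Prop}
    {p : StarTuple n D → Prop} [DecidablePred q] [DecidablePred p] (h : ∀ t, q t ↔ p (toTuple t)) :
    toCyl (X.filter fun t => q t) = (toCyl X).filter p := by
  ext r
  simp only [mem_toCyl, List.mem_filter, Finset.mem_filter, decide_eq_true_eq, h]
  constructor
  · rintro ⟨x, ⟨hx, hp⟩, rfl⟩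
    exact ⟨⟨x, hx, rfl⟩, hp⟩
  · rintro ⟨⟨x, hx, rfl⟩, hp⟩
    exact ⟨x, ⟨hx, hp⟩, rfl⟩

/-- Inner cylindrification of the positive algebra. -/
def innerPosList (i : Fin n) (X : List (ListTuple n D)) : List (ListTuple n D) :=
  X.filter fun t => t.1 i = none ∧ ∀ j, j ≠ i → Lit.eq s(i, j) ∉ t.2

theorem toCyl_innerPosList (i : Fin n) (X : List (ListTuple n D)) :
    toCyl (innerPosList i X) = innerPos i (toCyl X) := by
  exact toCyl_filter X fun t => by simp [toTuple]

/-- The tuple of the sieve with entries `t` in which the pairs in `S` are equated. -/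
def sieveTupleList (A : List D) (t : Fin n → Option D) (S : List (Sym2 (Fin n))) :
    ListTuple n D :=
  (t, (((List.finRange n).filter fun i => t i = none).flatMap fun i =>
    A.map fun a => .neConst i a) ++ S.map .eq ++
    ((pairList n).filter fun p => (∀ i, i ∈ p → t i = none) ∧ p ∉ S).map .ne)

theorem toTuple_sieveTupleList (A : List D) (t : Fin n → Option D) (S : List (Sym2 (Fin n))) :
    toTuple (sieveTupleList A t S) = sieveTuple A.toFinset t S.toFinset := by
  simp only [toTuple, sieveTupleList, sieveTuple, StarTuple.mk.injEq, true_and]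
  ext l
  simp [mem_pairList, starPairs, and_assoc]

variable (n) in
/-- All sets of pairs of columns: a list that depends on `n` only and thus is a constant of the
program. -/
def pairSets : List (List (Sym2 (Fin n))) :=
  (Finset.univ : Finset (Finset (Sym2 (Fin n)))).toList.map Finset.toList

variable (n) in
/-- The sieve: a filter on the candidates given by the entries and by the set of equated pairs. -/
def sieveList (A : List D) : List (ListTuple n D) :=
  (piList (none :: A.map some) n).flatMap fun t => ((pairSets n).filter fun S =>
    (∀ p ∈ S, ¬ p.IsDiag ∧ ∀ i, i ∈ p → t i = none) ∧ models (sieveTupleList A t S) ≠ []).map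
      fun S => sieveTupleList A t S

theorem toCyl_sieveList [Infinite D] (A : List D) : toCyl (sieveList n A) = sieve n A.toFinset := by
  ext r
  simp only [mem_toCyl, sieveList, sieve, List.mem_flatMap, List.mem_map, List.mem_filter,
    mem_piList, Finset.mem_filter, Finset.mem_biUnion, Finset.mem_image, Fintype.mem_piFinset,
    decide_eq_true_eq, Finset.mem_powerset, pairSets, Finset.mem_toList, Finset.mem_univ, true_and,
    List.mem_cons]
  have hmem : ∀ x : Option D, (x = none ∨ ∃ a ∈ A, some a = x) ↔
      x ∈ Finset.insertNone A.toFinset := fun x => by cases x <;> simp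
  have hsub : ∀ (t : Fin n → Option D) (S : Finset (Sym2 (Fin n))),
      (∀ p ∈ S.toList, ¬ p.IsDiag ∧ ∀ i, i ∈ p → t i = none) ↔ S ⊆ starPairs t := fun t S => by
    simp [Finset.subset_iff, starPairs]
  simp only [hmem]
  constructor
  · rintro ⟨_, ⟨t, ht, _, ⟨⟨S, rfl⟩, hS, hm⟩, rfl⟩, rfl⟩
    rw [hsub] at hS
    rw [← satisfiable_iff] at hm
    exact ⟨⟨t, ht, S, hS, by rw [toTuple_sieveTupleList, Finset.toList_toFinset]⟩, hm⟩
  · rintro ⟨⟨t, ht, S, hS, rfl⟩, hm⟩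
    have e : toTuple (sieveTupleList A t S.toList) = sieveTuple A.toFinset t S := by
      rw [toTuple_sieveTupleList, Finset.toList_toFinset]
    exact ⟨_, ⟨t, ht, _, ⟨⟨S, rfl⟩, (hsub t S).2 hS, by rwa [← satisfiable_iff, e]⟩, rfl⟩, e⟩

/-- Complement relative to the sieve. -/
def complList (A : List D) (X : List (ListTuple n D)) : List (ListTuple n D) :=
  (sieveList n A).filter fun t => interList [t] X = []

theorem toCyl_eq_empty {X : List (ListTuple n D)} : toCyl X = ∅ ↔ X = [] := by
  simp [toCyl]

theorem toCyl_singleton (t : ListTuple n D) : toCyl [t] = {toTuple t} := by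
  simp [toCyl]

theorem toCyl_complList [Infinite D] (A : List D) (X : List (ListTuple n D)) :
    toCyl (complList A X) = compl A.toFinset (toCyl X) := by
  rw [compl, ← toCyl_sieveList]
  exact toCyl_filter _ fun t => by rw [← toCyl_singleton, ← toCyl_interList, toCyl_eq_empty]

/-- Domination of star-cylinders. -/
def DominatedList (X Y : List (ListTuple n D)) : Prop :=
  ∀ t ∈ X, ∃ u ∈ Y, (toTuple t).Dominated (toTuple u)

theorem dominatedList_iff {X Y : List (ListTuple n D)} :
    DominatedList X Y ↔ Dominated (toCyl X) (toCyl Y) := by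
  simp only [DominatedList, Dominated, mem_toCyl]
  constructor
  · rintro h _ ⟨t, ht, rfl⟩
    obtain ⟨u, hu, h⟩ := h t ht
    exact ⟨_, ⟨u, hu, rfl⟩, h⟩
  · intro h t ht
    obtain ⟨_, ⟨u, hu, rfl⟩, h⟩ := h _ ⟨t, ht, rfl⟩
    exact ⟨u, hu, h⟩

/-- Inner cylindrification of the algebra with negation. -/
def innerList (A : List D) (i : Fin n) (X : List (ListTuple n D)) : List (ListTuple n D) :=
  (interList X (sieveList n A)).filter fun t =>
    DominatedList (interList (outerList i [t]) (sieveList n A)) (interList X (sieveList n A))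

theorem toCyl_innerList [Infinite D] (A : List D) (i : Fin n) (X : List (ListTuple n D)) :
    toCyl (innerList A i X) = inner A.toFinset i (toCyl X) := by
  rw [inner, ← toCyl_sieveList, ← toCyl_interList]
  exact toCyl_filter _ fun t => by
    rw [dominatedList_iff, ← toCyl_singleton, ← toCyl_outerList, ← toCyl_interList]

/-- The constants of a sequence. -/
def seqConstList (X : Fin m → List (ListTuple n D)) : List D :=
  (List.finRange m).flatMap fun p => (X p).flatMap constList

theorem toFinset_seqConstList (X : Fin m → List (ListTuple n D)) :
    (seqConstList X).toFinset = seqConsts fun p => toCyl (X p) := by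
  ext a
  simp [seqConstList, seqConsts, mem_toCyl, mem_constList]

/-- The value of an expression, as a list that may contain repetitions. -/
def evalList (X : Fin m → List (ListTuple n D)) : Expr n m → List (ListTuple n D)
  | .cyl p => X p
  | .diag i j => [(fun _ => none, [.eq s(i, j)])]
  | .union E F => evalList X E ++ evalList X F
  | .inter E F => interList (evalList X E) (evalList X F)
  | .outer i E => outerList i (evalList X E)
  | .inner i E => innerList (seqConstList X) i (evalList X E)
  | .compl E => complList (seqConstList X) (evalList X E)

/-- The value of a negation-free expression in the positive star algebra. -/
def evalPosList (X : Fin m → List (ListTuple n D)) :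
    (E : Expr n m) → E.NegFree → List (ListTuple n D)
  | .cyl p, _ => X p
  | .diag i j, _ => [(fun _ => none, [.eq s(i, j)])]
  | .union E F, h => evalPosList X E h.1 ++ evalPosList X F h.2
  | .inter E F, h => interList (evalPosList X E h.1) (evalPosList X F h.2)
  | .outer i E, h => outerList i (evalPosList X E h)
  | .inner i E, h => innerPosList i (evalPosList X E h)
  | .compl _, h => h.elim

theorem toCyl_diagonal (i j : Fin n) :
    toCyl [(fun _ => none, [Lit.eq s(i, j)])] = (diagonal i j : StarCyl n D) := by
  simp [toCyl_singleton, toTuple, diagonal]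

theorem toCyl_evalList [Infinite D] (X : Fin m → List (ListTuple n D)) (E : Expr n m) :
    toCyl (evalList X E) = eval (fun p => toCyl (X p)) E := by
  induction E with
  | cyl p => rfl
  | diag i j => exact toCyl_diagonal i j
  | union E F hE hF => rw [evalList, toCyl_append, hE, hF]; rfl
  | inter E F hE hF => rw [evalList, toCyl_interList, hE, hF]; rfl
  | outer i E hE => rw [evalList, toCyl_outerList, hE]; rfl
  | inner i E hE => rw [evalList, toCyl_innerList, hE, toFinset_seqConstList]; rfl
  | compl E hE => rw [evalList, toCyl_complList, hE, toFinset_seqConstList]; rfl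

theorem toCyl_evalPosList [Infinite D] (X : Fin m → List (ListTuple n D)) (E : Expr n m)
    (h : E.NegFree) : toCyl (evalPosList X E h) = evalPos (fun p => toCyl (X p)) E h := by
  induction E with
  | cyl p => rfl
  | diag i j => exact toCyl_diagonal i j
  | union E F hE hF => rw [evalPosList, toCyl_append, hE, hF]; rfl
  | inter E F hE hF => rw [evalPosList, toCyl_interList, hE, hF]; rfl
  | outer i E hE => exact (toCyl_outerList i _).trans (congrArg _ (hE h))
  | inner i E hE => exact (toCyl_innerPosList i _).trans (congrArg _ (hE h))
  | compl E hE => exact h.elim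

/-- Removal of repetitions, up to the relation `r`; the last occurrence is kept. -/
def dedupBy {α : Type*} (r : α → α → Prop) (l : List α) : List α :=
  flatMapTails l fun a l' => if ∃ b ∈ l', r a b then [] else [a]

theorem dedupBy_cons {α : Type*} (r : α → α → Prop) (a : α) (l : List α) :
    dedupBy r (a :: l) = if ∃ b ∈ l, r a b then dedupBy r l else a :: dedupBy r l := by
  by_cases h : ∃ b ∈ l, r a b <;> simp [dedupBy, flatMapTails, h]

theorem mem_of_mem_dedupBy {α : Type*} {r : α → α → Prop} {a : α} {l : List α}
    (h : a ∈ dedupBy r l) : a ∈ l := by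
  induction l with
  | nil => exact h
  | cons b l ih =>
    rw [dedupBy_cons] at h
    split at h
    · exact List.mem_cons_of_mem _ (ih h)
    · exact List.mem_cons.2 ((List.mem_cons.1 h).imp_right ih)

theorem map_dedupBy {α β : Type*} {r : α → α → Prop} {f : α → β}
    (hr : ∀ a b, r a b ↔ f a = f b) (l : List α) :
    ((dedupBy r l).map f).Nodup ∧ ((dedupBy r l).map f).toFinset = (l.map f).toFinset := by
  induction l with
  | nil => simp [dedupBy, flatMapTails]
  | cons a l ih =>
    rw [dedupBy_cons]
    have hm : (∃ b ∈ l, r a b) ↔ f a ∈ (l.map f).toFinset := by simp [hr, eq_comm]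
    split
    · next h => exact ⟨ih.1, by rw [ih.2, List.map_cons, List.toFinset_cons,
        Finset.insert_eq_of_mem (hm.1 h)]⟩
    · next h =>
      rw [List.map_cons, List.map_cons, List.toFinset_cons, List.toFinset_cons, ih.2]
      refine ⟨List.nodup_cons.2 ⟨fun h' => h (hm.2 ?_), ih.1⟩, rfl⟩
      rw [← ih.2]
      exact List.mem_toFinset.2 h'

/-- The star-cylinder without repetition of literals or star-tuples. -/
def dedupCyl (X : List (ListTuple n D)) : List (ListTuple n D) :=
  dedupBy (fun t u => t.1 = u.1 ∧ (∀ l ∈ t.2, l ∈ u.2) ∧ ∀ l ∈ u.2, l ∈ t.2)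
    (X.map fun t => (t.1, dedupBy (fun l l' => l = l') t.2))

theorem dedupCyl_spec (X : List (ListTuple n D)) :
    ((dedupCyl X).map toTuple).Nodup ∧ toCyl (dedupCyl X) = toCyl X ∧
      ∀ t ∈ dedupCyl X, t.2.Nodup := by
  have hl : ∀ l : List (Lit n D), (dedupBy (fun l l' => l = l') l).Nodup ∧
      (dedupBy (fun l l' => l = l') l).toFinset = l.toFinset := fun l => by
    simpa using map_dedupBy (f := fun l : Lit n D => l) (fun _ _ => Iff.rfl) l
  have ht : ∀ t : ListTuple n D, toTuple (t.1, dedupBy (fun l l' => l = l') t.2) = toTuple t :=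
    fun t => by simp [toTuple, (hl t.2).2]
  have := map_dedupBy (r := fun t u : ListTuple n D => t.1 = u.1 ∧ (∀ l ∈ t.2, l ∈ u.2) ∧
    ∀ l ∈ u.2, l ∈ t.2) (f := toTuple) (fun t u => by
      simp only [toTuple, StarTuple.mk.injEq, Finset.ext_iff, List.mem_toFinset, iff_def,
        forall_and]) (X.map fun t => (t.1, dedupBy (fun l l' => l = l') t.2))
  refine ⟨this.1, this.2.trans ?_, fun t h => ?_⟩
  · simp [toCyl, Function.comp_def, ht]
  · obtain ⟨u, _, rfl⟩ := List.mem_map.1 (mem_of_mem_dedupBy h)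
    exact (hl u.2).1

end

/-! ### The list operations take polynomial time -/

section

variable {n m : ℕ} {D : Type*} {α γ : Type*} [Code D α] [Code D γ]

theorem PolyFun.finRange (k : ℕ) : PolyFun D fun _ : γ => List.finRange k :=
  .const_list fun i _ => .fin i

theorem PolyFun.pairList : PolyFun D fun _ : γ => pairList n := .const_list fun p _ => .sym2 p

theorem PolyFun.piList {f : γ → List α} (hf : PolyFun D f) (k : ℕ) :
    PolyFun D fun c => SCA.piList (f c) k := by
  induction k with
  | zero => exact .cons (.pi fun i => i.elim0) .nil
  | succ k ih =>
    refine hf.flatMap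
      (.map (ih.comp (.snd .id)) (.pi fun i => ?_))
    cases i using Fin.cases with
    | zero => exact (PolyFun.id.snd.fst (D := D)).congr fun _ => rfl
    | succ i => exact ((PolyFun.id.fst (D := D)).apply i).congr fun _ => rfl

theorem PolyFun.lit_constList : PolyFun D fun l : Lit n D => l.constList :=
  .lit_cases (f := fun l (_ : Lit n D) => l.constList) .id (fun _ => .nil) (fun _ => .nil)
    fun _ => .cons (.fst .id) .nil

theorem PolyFun.constList : PolyFun D fun t : ListTuple n D => constList t := by
  refine .append (.flatMap (.finRange n) ?_)
    (.flatMap (.snd .id) (lit_constList.comp (.fst .id)))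
  refine .fin_cases (f := fun i (q : Fin n × ListTuple n D) => (q.2.1 i).toList) (.fst .id)
    fun i => ?_
  exact .option_cases (f := fun x (_ : Fin n × ListTuple n D) => x.toList)
    ((PolyFun.id.snd.fst (D := D)).apply i) .nil (.cons (.fst .id) .nil)

theorem PolyFun.seqConstList :
    PolyFun D fun X : Fin m → List (ListTuple n D) => seqConstList X := by
  refine .flatMap (.finRange m) ?_
  refine .fin_cases
    (f := fun p (q : Fin m × (Fin m → List (ListTuple n D))) => (q.2 p).flatMap SCA.constList)
    (.fst .id) fun p => ?_
  exact .flatMap ((PolyFun.id.snd (D := D)).apply p) (PolyFun.constList.comp (.fst .id))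

theorem PolyPred.lit_holdsIn :
    PolyPred D fun q : Lit n D × (Fin n → D ⊕ Fin n) => q.1.HoldsIn q.2 := by
  have hp : ∀ p : Sym2 (Fin n), PolyPred D
      fun q : Lit n D × (Fin n → D ⊕ Fin n) => (p.map q.2).IsDiag := fun p => by
    induction p with
    | h i j =>
      exact (PolyPred.eq_sum (PolyFun.id.snd.apply i) (PolyFun.id.snd.apply j)).congr
        fun c => by simp
  refine .lit_cases (p := fun l (q : Lit n D × (Fin n → D ⊕ Fin n)) => l.HoldsIn q.2) (.fst .id)
    hp (fun p => (hp p).not) fun i => ?_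
  exact (PolyPred.eq_sum (PolyFun.id.snd.snd.apply i) (.inl (.fst .id))).not

theorem PolyPred.holdsIn :
    PolyPred D fun q : ListTuple n D × (Fin n → D ⊕ Fin n) => HoldsIn q.1 q.2 := by
  refine .and (.forall_finite fun i => ?_)
    (.forall_mem (.snd (.fst .id))
      (lit_holdsIn.comp (.pair (.fst .id) (.snd (.snd .id)))))
  refine .option_cases (p := fun x (q : ListTuple n D × (Fin n → D ⊕ Fin n)) =>
    ∀ a, x = some a → q.2 i = .inl a) ((PolyFun.id.fst.fst (D := D)).apply i) ?_ ?_
  · exact (PolyPred.const True).congr fun c => by simp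
  · exact (PolyPred.eq_sum (PolyFun.id.snd.snd.apply i) (.inl (.fst .id))).congr fun c => by simp

theorem PolyFun.models : PolyFun D fun t : ListTuple n D => models t := by
  refine .filter (.piList (.append
    (.map .constList (.inl (.fst .id)))
    (.map (.finRange n) (.inr (.fst .id)))) n)
    (PolyPred.holdsIn.comp (.pair (.snd .id) (.fst .id)))

theorem PolyFun.forcedList : PolyFun D fun t : ListTuple n D => forcedList t := by
  refine .pi fun i => .head? (.filter .constList
    (.forall_mem (PolyFun.models.comp (.snd .id))
      (.eq_sum ((PolyFun.id.fst (D := D)).apply i) (.inl (.fst (.snd .id))))))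

theorem PolyFun.litList {f : γ → List D} (hf : PolyFun D f) :
    PolyFun D fun c => litList n (f c) := by
  refine .append (.append (.map .pairList (.lit_eq (.fst .id)))
    (.map .pairList (.lit_ne (.fst .id))))
    (.flatMap (.finRange n)
      (.map (hf.comp (.snd .id))
        (.lit_neConst (.fst (.snd .id)) (.fst .id))))

theorem PolyPred.mentions (i : Fin n) : PolyPred D fun l : Lit n D => l.Mentions i :=
  .lit_cases (p := fun l (_ : Lit n D) => l.Mentions i) .id (fun _ => .const _) (fun _ => .const _)
    fun _ => .const _

theorem PolyFun.normalizeList : PolyFun D fun t : ListTuple n D => normalizeList t := by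
  refine .ite (.eq_nil .models) .nil (.cons (.pair .forcedList
    (.filter (.litList .constList) (.and ?_ ?_))) .nil)
  · exact .forall_mem (PolyFun.models.comp (.snd .id))
      (PolyPred.lit_holdsIn.comp (.pair (.fst (.snd .id)) (.fst .id)))
  · exact .forall_finite fun i => .imp ((PolyPred.mentions i).comp (.fst .id))
      (.eq_option ((PolyFun.forcedList.comp (.snd .id)).apply i) .none)

theorem PolyFun.meetList :
    PolyFun D fun q : ListTuple n D × ListTuple n D => meetList q.1 q.2 := by
  have h1 : ∀ j : Fin n, PolyFun D fun q : ListTuple n D × ListTuple n D => q.1.1 j := fun j =>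
    (PolyFun.id.fst.fst (D := D)).apply j
  have h2 : ∀ j : Fin n, PolyFun D fun q : ListTuple n D × ListTuple n D => q.2.1 j := fun j =>
    (PolyFun.id.snd.fst (D := D)).apply j
  refine .ite (.exists_finite fun j => .and (PolyPred.not (.eq_option (h1 j) .none))
    (.and (PolyPred.not (.eq_option (h2 j) .none)) (PolyPred.not (.eq_option (h1 j) (h2 j))))) .nil
    (PolyFun.normalizeList.comp (.pair (.pi fun j => ?_)
      (.append (.snd (.fst .id)) (.snd (.snd .id)))))
  exact .option_cases (f := fun x (q : ListTuple n D × ListTuple n D) => x.or (q.2.1 j)) (h1 j)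
    (h2 j) (.some (.fst .id))

theorem PolyFun.interList {f g : γ → List (ListTuple n D)} (hf : PolyFun D f) (hg : PolyFun D g) :
    PolyFun D fun c => interList (f c) (g c) :=
  hf.flatMap
    (.flatMap (hg.comp (.snd .id))
      (PolyFun.meetList.comp (.pair (.fst (.snd .id)) (.fst .id))))

theorem PolyFun.outerList {f : γ → List (ListTuple n D)} (hf : PolyFun D f) (i : Fin n) :
    PolyFun D fun c => outerList i (f c) := by
  refine hf.map (.pair (.pi fun j => ?_)
      (.filter (.snd (.fst .id))
        ((PolyPred.mentions i).comp (.fst .id)).not))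
  exact .ite (.const _) .none ((PolyFun.id.fst.fst (D := D)).apply j)

theorem PolyFun.innerPosList {f : γ → List (ListTuple n D)} (hf : PolyFun D f) (i : Fin n) :
    PolyFun D fun c => innerPosList i (f c) := by
  refine hf.filter
    (.and (.eq_option ((PolyFun.id.fst.fst (D := D)).apply i) .none)
      (.forall_finite fun j => .imp (.const _) (PolyPred.not ?_)))
  exact .mem_lit (.lit_eq (.sym2 _)) (.snd (.fst .id))

theorem PolyFun.sieveList {f : γ → List D} (hf : PolyFun D f) :
    PolyFun D fun c => sieveList n (f c) := by
  have hS : PolyFun D fun q : List (Sym2 (Fin n)) × (Fin n → Option D) × γ =>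
      sieveTupleList (f q.2.2) q.2.1 q.1 := by
    have ht : ∀ i : Fin n, PolyFun D
        fun q : List (Sym2 (Fin n)) × (Fin n → Option D) × γ => q.2.1 i :=
      fun i => PolyFun.id.snd.fst.apply i
    refine .pair (.fst (.snd .id)) (.append (.append (.flatMap (.filter (.finRange n) ?_)
        (.map (hf.comp (.snd (.snd (.snd .id))))
          (.lit_neConst (.fst (.snd .id)) (.fst .id)))) (.map (.fst .id)
        (.lit_eq (.fst .id)))) (.map (.filter .pairList ?_)
          (.lit_ne (.fst .id))))
    · exact .fin_cases (p := fun i (q : Fin n × List (Sym2 (Fin n)) × (Fin n → Option D) × γ) =>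
        q.2.2.1 i = Option.none) (.fst .id) fun i => .eq_option ((ht i).comp (.snd .id)) .none
    · refine .and (.sym2_cases (p := fun p
        (q : Sym2 (Fin n) × List (Sym2 (Fin n)) × (Fin n → Option D) × γ) =>
          ∀ i, i ∈ p → q.2.2.1 i = Option.none) (.fst .id) fun p => .forall_finite fun i =>
            .imp (.const _) (.eq_option ((ht i).comp (.snd .id)) .none)) (PolyPred.not ?_)
      exact (PolyPred.exists_mem (D := D)
        (f := fun q : Sym2 (Fin n) × List (Sym2 (Fin n)) × (Fin n → Option D) × γ => q.2.1)
        (p := fun (q : Sym2 (Fin n) × List (Sym2 (Fin n)) × (Fin n → Option D) × γ) p => p = q.1)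
        (.fst (.snd .id))
        (.eq_sym2 (.fst .id) (.fst (.snd .id)))).congr fun q => by simp
  refine .flatMap
    (.piList (.cons .none (.map hf (.some (.fst .id)))) n) ?_
  refine .map (.filter ?_ (.and ?_ ?_)) hS
  · exact .const_list fun S _ => .const_list fun p _ => .sym2 p
  · refine .forall_mem (.fst .id) ?_
    exact .sym2_cases (p := fun p
      (q : Sym2 (Fin n) × List (Sym2 (Fin n)) × (Fin n → Option D) × γ) =>
        ¬ p.IsDiag ∧ ∀ i, i ∈ p → q.2.2.1 i = Option.none) (.fst .id) fun p => .and (.const _)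
      (.forall_finite fun i => .imp (.const _)
        (.eq_option ((PolyFun.id.snd.snd.fst (D := D)).apply i) .none))
  · exact PolyPred.not (.eq_nil (PolyFun.models.comp hS))

theorem PolyFun.complList {f : γ → List D} {g : γ → List (ListTuple n D)} (hf : PolyFun D f)
    (hg : PolyFun D g) : PolyFun D fun c => complList (f c) (g c) :=
  hf.sieveList.filter
    (.eq_nil (.interList (.cons (.fst .id) .nil) (hg.comp (.snd .id))))

theorem PolyPred.forces :
    PolyPred D fun q : Lit n D × ListTuple n D => (toTuple q.2).Forces q.1 := by
  have ht : ∀ i : Fin n, PolyFun D fun q : Lit n D × ListTuple n D => q.2.1 i :=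
    fun i => PolyFun.id.snd.fst.apply i
  have hl : PolyFun D fun q : Lit n D × ListTuple n D => q.2.2 := .snd (.snd .id)
  refine .lit_cases (p := fun l (q : Lit n D × ListTuple n D) => (toTuple q.2).Forces l) (.fst .id)
    (fun p => .forall_finite fun i => .forall_finite fun j => .imp (.const _) ?_)
    (fun p => .forall_finite fun i => .forall_finite fun j => .imp (.const _) ?_) fun i => ?_
  · refine (PolyPred.cond (.and (.eq_option (ht i) .none) (.eq_option (ht j) .none))
      (.or (.const (i = j)) (.mem_lit (.lit_eq (.sym2 s(i, j))) hl))
      (.eq_option (ht i) (ht j))).congr fun q => ?_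
    by_cases h : q.2.1 i = none ∧ q.2.1 j = none <;> simp [toTuple, h]
  · refine .option_cases (p := fun x (q : Lit n D × ListTuple n D) =>
      match x, q.2.1 j with
      | none, none => Lit.ne s(i, j) ∈ q.2.2.toFinset
      | some a, none => Lit.neConst j a ∈ q.2.2.toFinset
      | none, some b => Lit.neConst i b ∈ q.2.2.toFinset
      | some a, some b => a ≠ b) (ht i) ?_ ?_
    · refine .option_cases (p := fun x (q : Lit n D × ListTuple n D) =>
        match (none : Option D), x with
        | none, none => Lit.ne s(i, j) ∈ q.2.2.toFinset
        | some a, none => Lit.neConst j a ∈ q.2.2.toFinset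
        | none, some b => Lit.neConst i b ∈ q.2.2.toFinset
        | some a, some b => a ≠ b) (ht j) ?_ ?_
      · exact (PolyPred.mem_lit (.lit_ne (.sym2 s(i, j))) hl).congr fun q => by simp
      · exact (PolyPred.mem_lit (.lit_neConst (.fin i) (.fst .id)) (hl.comp (.snd .id))).congr
          fun q => by simp
    · refine .option_cases (p := fun x (q : D × Lit n D × ListTuple n D) =>
        match some q.1, x with
        | none, none => Lit.ne s(i, j) ∈ q.2.2.2.toFinset
        | some a, none => Lit.neConst j a ∈ q.2.2.2.toFinset
        | none, some b => Lit.neConst i b ∈ q.2.2.2.toFinset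
        | some a, some b => a ≠ b) ((ht j).comp (.snd .id)) ?_ ?_
      · exact (PolyPred.mem_lit (.lit_neConst (.fin j) (.fst .id)) (hl.comp (.snd .id))).congr
          fun q => by simp
      · exact PolyPred.not (.eq_atom (.fst (.snd .id)) (.fst .id))
  · refine .option_cases (p := fun x (q : D × Lit n D × ListTuple n D) =>
      match x with
      | none => Lit.neConst i q.1 ∈ q.2.2.2.toFinset
      | some b => b ≠ q.1) ((ht i).comp (.snd .id)) ?_ ?_
    · exact (PolyPred.mem_lit (.lit_neConst (.fin i) (.fst .id)) (hl.comp (.snd .id))).congr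
          fun q => by simp
    · exact PolyPred.not (.eq_atom (.fst .id) (.fst (.snd .id)))

theorem PolyPred.dominatedList {f g : γ → List (ListTuple n D)} (hf : PolyFun D f)
    (hg : PolyFun D g) : PolyPred D fun c => DominatedList (f c) (g c) := by
  refine .forall_mem hf
    (.exists_mem (hg.comp (.snd .id))
      (.and (.forall_finite fun i => ?_) ?_))
  · have h1 : PolyFun D fun q : ListTuple n D × ListTuple n D × γ => q.1.1 i :=
      PolyFun.id.fst.fst.apply i
    have h2 : PolyFun D fun q : ListTuple n D × ListTuple n D × γ => q.2.1.1 i :=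
      PolyFun.id.snd.fst.fst.apply i
    exact .or (.eq_option h1 .none) (.eq_option h2 h1)
  · refine (PolyPred.forall_mem (D := D)
      (f := fun q : ListTuple n D × ListTuple n D × γ => q.1.2)
      (p := fun (q : ListTuple n D × ListTuple n D × γ) l => (toTuple q.2.1).Forces l)
      (.snd (.fst .id)) (PolyPred.forces.comp (.pair (.fst .id) (.fst (.snd (.snd .id)))))).congr
        fun q => ?_
    simp [toTuple]

theorem PolyFun.innerList {f : γ → List D} {g : γ → List (ListTuple n D)} (hf : PolyFun D f)
    (hg : PolyFun D g) (i : Fin n) : PolyFun D fun c => innerList (f c) i (g c) :=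
  (hg.interList hf.sieveList).filter
    (.dominatedList (.interList (.outerList (.cons (.fst .id) .nil) i)
        (hf.sieveList.comp (.snd .id)))
      ((hg.interList hf.sieveList).comp (.snd .id)))

theorem PolyFun.diagonal (i j : Fin n) : PolyFun D fun _ : γ =>
    ([(fun _ => Option.none, [Lit.eq s(i, j)])] : List (ListTuple n D)) :=
  .cons (.pair (.pi fun _ => .none) (.cons (.lit_eq (.sym2 _)) .nil)) .nil

theorem PolyFun.evalList (E : Expr n m) :
    PolyFun D fun X : Fin m → List (ListTuple n D) => evalList X E := by
  induction E with
  | cyl p => exact PolyFun.id.apply p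
  | diag i j => exact .diagonal i j
  | union E F hE hF => exact hE.append hF
  | inter E F hE hF => exact hE.interList hF
  | outer i E hE => exact hE.outerList i
  | inner i E hE => exact .innerList .seqConstList hE i
  | compl E hE => exact .complList .seqConstList hE

theorem PolyFun.evalPosList (E : Expr n m) (h : E.NegFree) :
    PolyFun D fun X : Fin m → List (ListTuple n D) => evalPosList X E h := by
  induction E with
  | cyl p => exact PolyFun.id.apply p
  | diag i j => exact .diagonal i j
  | union E F hE hF => exact (hE h.1).append (hF h.2)
  | inter E F hE hF => exact (hE h.1).interList (hF h.2)
  | outer i E hE => exact (hE h).outerList i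
  | inner i E hE => exact (hE h).innerPosList i
  | compl E hE => exact h.elim

theorem PolyFun.dedupBy {f : γ → List α} {r : α → α → Prop} (hf : PolyFun D f)
    (hr : PolyPred D fun q : α × α => r q.1 q.2) : PolyFun D fun c => dedupBy r (f c) :=
  hf.flatMapTails
    (.ite (.exists_mem (.snd (.fst .id))
      (hr.comp (.pair (.fst (.fst (.snd .id))) (.fst .id)))) .nil (.cons (.fst (.fst .id)) .nil))

theorem PolyFun.dedupCyl {f : γ → List (ListTuple n D)} (hf : PolyFun D f) :
    PolyFun D fun c => dedupCyl (f c) := by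
  refine .dedupBy (hf.map
    (.pair (.fst (.fst .id)) (.dedupBy (.snd (.fst .id)) (.eq_lit (.fst .id) (.snd .id))))) ?_
  refine .and (.eq_pi (.fst (.fst .id)) (.fst (.snd .id))) (.and ?_ ?_)
  · exact .forall_mem (.snd (.fst .id))
      (.mem_lit (.fst .id) (.snd (.snd (.snd .id))))
  · exact .forall_mem (.snd (.snd .id))
      (.mem_lit (.fst .id) (.snd (.fst (.snd .id))))

end

/-! ### Representations and their size -/

section

variable {n m : ℕ} {D : Type*}

theorem tupleCode_iff {x : Val D} {t : StarTuple n D} :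
    TupleCode x t ↔ ∃ u : ListTuple n D, toTuple u = t ∧ u.2.Nodup ∧ x = Code.code u := by
  constructor
  · rintro ⟨L, hL, ht, rfl⟩
    exact ⟨(t.val, L), by simp [toTuple, ht], hL, rfl⟩
  · rintro ⟨u, rfl, hu, rfl⟩
    exact ⟨u.2, hu, rfl, rfl⟩

theorem cylCode_iff {x : Val D} {C : StarCyl n D} :
    CylCode x C ↔ ∃ X : List (ListTuple n D), (X.map toTuple).Nodup ∧ toCyl X = C ∧
      (∀ t ∈ X, t.2.Nodup) ∧ x = Code.code X := by
  constructor
  · rintro ⟨L, X, hL, hC, hX, rfl⟩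
    have key : ∃ Y : List (ListTuple n D), Y.map toTuple = L ∧ (∀ t ∈ Y, t.2.Nodup) ∧
        X = Y.map Code.code := by
      clear hL hC
      induction hX with
      | nil => exact ⟨[], by simp⟩
      | cons h _ ih =>
        obtain ⟨u, rfl, hu, rfl⟩ := tupleCode_iff.1 h
        obtain ⟨Y, rfl, hY, rfl⟩ := ih
        exact ⟨u :: Y, rfl, by simpa using ⟨hu, fun a b h => hY (a, b) h⟩, rfl⟩
    obtain ⟨Y, rfl, hY, rfl⟩ := key
    exact ⟨Y, hL, hC, hY, rfl⟩
  · rintro ⟨X, hX, rfl, hn, rfl⟩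
    refine ⟨_, X.map Code.code, hX, rfl, ?_, rfl⟩
    clear hX
    induction X with
    | nil => exact .nil
    | cons t X ih =>
      exact .cons (tupleCode_iff.2 ⟨t, rfl, hn t (by simp), rfl⟩)
        (ih fun u hu => hn u (by simp [hu]))

theorem seqCode_iff {x : Val D} {C : Fin m → StarCyl n D} :
    SeqCode x C ↔ ∃ X : Fin m → List (ListTuple n D), (∀ p, ((X p).map toTuple).Nodup ∧
      toCyl (X p) = C p ∧ ∀ t ∈ X p, t.2.Nodup) ∧ x = Code.code X := by
  constructor
  · rintro ⟨X, hX, rfl⟩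
    choose Y h1 h2 h3 h4 using fun p => cylCode_iff.1 (hX p)
    obtain rfl : X = fun p => Code.code (Y p) := funext h4
    exact ⟨Y, fun p => ⟨h1 p, h2 p, h3 p⟩, rfl⟩
  · rintro ⟨Y, hY, rfl⟩
    exact ⟨fun p => Code.code (Y p), fun p =>
      cylCode_iff.2 ⟨Y p, (hY p).1, (hY p).2.1, (hY p).2.2, rfl⟩, rfl⟩

theorem exists_seqCode (C : Fin m → StarCyl n D) : ∃ x, SeqCode x C := by
  refine ⟨_, seqCode_iff.2 ⟨fun p => (C p).toList.map fun t => (t.val, t.cond.toList),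
    fun p => ?_, rfl⟩⟩
  have h : ((C p).toList.map fun t => ((t.val, t.cond.toList) : ListTuple n D)).map toTuple =
      (C p).toList := by
    simp [Function.comp_def, toTuple]
  refine ⟨h ▸ (C p).nodup_toList, by rw [toCyl, h, Finset.toList_toFinset], fun t ht => ?_⟩
  obtain ⟨u, _, rfl⟩ := List.mem_map.1 ht
  exact u.cond.nodup_toList

theorem Val.sz_ofNat (k : ℕ) : (Val.ofNat k : Val D).sz = 2 * k + 1 := by
  induction k with
  | zero => rfl
  | succ k ih => simp [Val.ofNat, Val.sz, ih]; omega

theorem sz_ofList_le {l : List (Val D)} {N B : ℕ} (hl : l.length ≤ N) (hB : ∀ x ∈ l, x.sz ≤ B) :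
    (Val.ofList l).sz ≤ N * (B + 1) + 1 := by
  rw [Val.sz_ofList]
  have := List.sum_le_card_nsmul (l.map fun x => x.sz + 1) (B + 1) (by simpa using hB)
  rw [List.length_map, smul_eq_mul] at this
  have := Nat.mul_le_mul_right (B + 1) hl
  omega

theorem Lit.sz_code_le (l : Lit n D) : l.code.sz ≤ 4 * n + 10 := by
  have h : ∀ i : Fin n, (i : ℕ) ≤ n := fun i => i.2.le
  cases l with
  | eq p =>
    have := h p.inf
    have := h p.sup
    simp only [Lit.code, pairCode, Val.sz, Val.sz_ofNat]; omega
  | ne p =>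
    have := h p.inf
    have := h p.sup
    simp only [Lit.code, pairCode, Val.sz, Val.sz_ofNat]; omega
  | neConst i a =>
    have := h i
    simp only [Lit.code, Val.sz, Val.sz_ofNat]; omega

theorem sz_tuple_le {t : ListTuple n D} {N : ℕ} (h : t.2.length ≤ N) :
    (Code.code t : Val D).sz ≤ (n * 2 + 1) + (N * (4 * n + 10 + 1) + 1) + 1 := by
  have h1 : (Code.code t.1 : Val D).sz ≤ n * (1 + 1) + 1 := by
    refine sz_ofList_le (by simp) fun x hx => ?_
    obtain ⟨i, rfl⟩ := List.mem_ofFn.1 hx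
    change (entryCode (t.1 i)).sz ≤ 1
    cases t.1 i <;> simp [entryCode, Val.sz]
  have h2 : (Code.code t.2 : Val D).sz ≤ N * (4 * n + 10 + 1) + 1 := by
    refine sz_ofList_le (by simpa using h) fun x hx => ?_
    obtain ⟨l, _, rfl⟩ := List.mem_map.1 hx
    exact l.sz_code_le
  change (Code.code t.1 : Val D).sz + (Code.code t.2 : Val D).sz + 1 ≤ _
  omega

/-- Codes of sequences have polynomial size, as entries have size `1` and codes of literals
have a size bounded in terms of `n`. -/
theorem exists_sz_le (n m : ℕ) : ∃ r : Polynomial ℕ, ∀ (D : Type*) (C : Fin m → StarCyl n D) x,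
    SeqCode x C → x.sz ≤ r.eval (seqSize C) := by
  let N : Polynomial ℕ := .X
  refine ⟨.C m * (N * (.C (n * 2 + 1) + (N * .C (4 * n + 10 + 1) + 1) + 1 + 1) + 1 + 1) + 1,
    fun D C x hx => ?_⟩
  obtain ⟨X, hX, rfl⟩ := seqCode_iff.1 hx
  have hcard : ∀ p, (X p).length ≤ seqSize C := fun p => by
    have h1 : (X p).length = (C p).card := by
      rw [← (hX p).2.1, toCyl, List.toFinset_card_of_nodup (hX p).1, List.length_map]
    rw [h1]
    exact (Finset.single_le_sum (f := fun p => (C p).card) (fun _ _ => Nat.zero_le _)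
      (Finset.mem_univ p)).trans (le_max_left _ _)
  have hcond : ∀ p, ∀ t ∈ X p, t.2.length ≤ seqSize C := fun p t ht => by
    have h1 : t.2.length = (toTuple t).cond.card :=
      (List.toFinset_card_of_nodup ((hX p).2.2 t ht)).symm
    have h2 : toTuple t ∈ C p := by
      rw [← (hX p).2.1]
      exact mem_toCyl.2 ⟨t, ht, rfl⟩
    rw [h1]
    exact ((Finset.le_sup (f := fun t => t.cond.card) h2).trans
      (Finset.le_sup (f := fun p => (C p).sup fun t => t.cond.card) (Finset.mem_univ p))).trans
      (le_max_right _ _)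
  simp only [Polynomial.eval_add, Polynomial.eval_mul, Polynomial.eval_X, Polynomial.eval_C,
    Polynomial.eval_one, N]
  refine sz_ofList_le (by simp) fun y hy => ?_
  obtain ⟨p, rfl⟩ := List.mem_ofFn.1 hy
  refine sz_ofList_le (by simpa using hcard p) fun y hy => ?_
  obtain ⟨t, ht, rfl⟩ := List.mem_map.1 hy
  exact sz_tuple_le (hcond p t ht)

theorem length_le_sz_code {α : Type*} [Code D α] (l : List α) :
    l.length ≤ (Code.code l : Val D).sz := by
  have h : (Code.code l : Val D) = .ofList (l.map Code.code) := rfl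
  rw [h, Val.sz_ofList]
  have := Val.length_le_sum (l.map (Code.code : α → Val D))
  rw [List.length_map] at this
  omega

theorem sz_code_le_of_mem {α : Type*} [Code D α] {l : List α} {a : α} (h : a ∈ l) :
    (Code.code a : Val D).sz ≤ (Code.code l : Val D).sz := by
  have e : (Code.code l : Val D) = .ofList (l.map Code.code) := rfl
  rw [e, Val.sz_ofList]
  have := List.single_le_sum (l := (l.map (Code.code : α → Val D)).map fun x => x.sz + 1)
    (fun _ _ => Nat.zero_le _) _
    (List.mem_map.2 ⟨Code.code a, List.mem_map.2 ⟨a, h, rfl⟩, rfl⟩)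
  omega

/-- A code has at least as many nodes as the star-cylinder has star-tuples, or literals in a
condition. -/
theorem size_le_sz {x : Val D} {C : StarCyl n D} (h : CylCode x C) : size C ≤ x.sz := by
  obtain ⟨X, hX, rfl, hn, rfl⟩ := cylCode_iff.1 h
  refine max_le ?_ (Finset.sup_le fun t ht => ?_)
  · rw [toCyl, List.toFinset_card_of_nodup hX, List.length_map]
    exact length_le_sz_code X
  · obtain ⟨u, hu, rfl⟩ := mem_toCyl.1 ht
    have h2 : (Code.code u : Val D).sz =
        (Code.code u.1 : Val D).sz + (Code.code u.2 : Val D).sz + 1 := rfl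
    have h3 := length_le_sz_code (D := D) u.2
    have h4 := sz_code_le_of_mem (D := D) hu
    have h5 : (toTuple u).cond.card = u.2.length := List.toFinset_card_of_nodup (hn u hu)
    omega

/-- A map of star-cylinders that is realized on lists by a polynomial-time function has values of
polynomial size, since these fit into the output, and is computed by a program in polynomial
time. -/
theorem exists_program {R : (Fin m → StarCyl n D) → StarCyl n D}
    {f : (Fin m → List (ListTuple n D)) → List (ListTuple n D)} (hf : PolyFun D f)
    (hR : ∀ X, toCyl (f X) = R fun p => toCyl (X p)) :
    ∃ π : Polynomial ℕ, (∀ C, size (R C) ≤ π.eval (seqSize C)) ∧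
      ∃ P : Prog, ∀ C, ComputesWithin P C (R C) (π.eval (seqSize C)) := by
  obtain ⟨F, ⟨p, hp, hP⟩, hF⟩ := hf.dedupCyl
  obtain ⟨P, hP⟩ := hP 0
  obtain ⟨r, hr⟩ := exists_sz_le n m
  have hcode : ∀ C x, SeqCode x C → CylCode (F x) (R C) := fun C x hx => by
    obtain ⟨X, hX, rfl⟩ := seqCode_iff.1 hx
    obtain ⟨h1, h2, h3⟩ := dedupCyl_spec (f X)
    obtain rfl : (fun p => toCyl (X p)) = C := funext fun p => (hX p).2.1
    exact cylCode_iff.2 ⟨_, h1, h2.trans (hR X), h3, hF X⟩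
  have hle : ∀ C x, SeqCode x C → p.eval x.sz ≤ (p.comp r).eval (seqSize C) := fun C x hx => by
    rw [Polynomial.eval_comp]
    exact eval_le_eval p (hr D C x hx)
  refine ⟨p.comp r, fun C => ?_, P, fun C x hx => ?_⟩
  · obtain ⟨x, hx⟩ := exists_seqCode C
    exact (size_le_sz (hcode C x hx)).trans ((hp x).trans (hle C x hx))
  · obtain ⟨k, s, hk, hrun, h0, _⟩ := hP (initStore x)
    have e : initStore x 0 = x := by simp [initStore]
    rw [e] at hk h0
    exact ⟨k, s, hk.trans (hle C x hx), hrun, h0 ▸ hcode C x hx⟩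

end

end SCA

end

theorem mainTheorem10 {D : Type*} [Infinite D] {n m : ℕ} (E : SCA.Expr n m) :
    ∃ π : Polynomial ℕ,
      (∀ C : Fin m → SCA.StarCyl n D,
        SCA.size (SCA.eval C E) ≤ π.eval (SCA.seqSize C)) ∧
      (∃ P : SCA.Prog, ∀ C : Fin m → SCA.StarCyl n D,
        SCA.ComputesWithin P C (SCA.eval C E) (π.eval (SCA.seqSize C))) ∧
      ∀ h : E.NegFree,
        (∀ C : Fin m → SCA.StarCyl n (SCA.Naive D), (∀ p, SCA.IsPositive (C p)) →
          SCA.size (SCA.evalPos C E h) ≤ π.eval (SCA.seqSize C)) ∧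
        ∃ P : SCA.Prog, ∀ C : Fin m → SCA.StarCyl n (SCA.Naive D), (∀ p, SCA.IsPositive (C p)) →
          SCA.ComputesWithin P C (SCA.evalPos C E h) (π.eval (SCA.seqSize C)) := by
  have mono : ∀ {D : Type _} {P : SCA.Prog} {C : Fin m → SCA.StarCyl n D} {R : SCA.StarCyl n D}
      {S T : ℕ}, S ≤ T → SCA.ComputesWithin P C R S → SCA.ComputesWithin P C R T :=
    fun hST h x hx => by
      obtain ⟨k, s, hk, hs⟩ := h x hx
      exact ⟨k, s, hk.trans hST, hs⟩
  obtain ⟨π, h1, P, h2⟩ := SCA.exists_program (R := fun C => SCA.eval C E)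
    (SCA.PolyFun.evalList (D := D) E)
    fun X => SCA.toCyl_evalList X E
  by_cases h : E.NegFree
  · obtain ⟨ρ, h3, Q, h4⟩ := SCA.exists_program (R := fun C => SCA.evalPos C E h)
      (SCA.PolyFun.evalPosList (D := SCA.Naive D) E h)
      fun X => SCA.toCyl_evalPosList X E h
    have e : ∀ a, (π + ρ).eval a = π.eval a + ρ.eval a := fun a => Polynomial.eval_add
    -- The one polynomial has to bound both evaluations.
    refine ⟨π + ρ, fun C => ?_, ⟨P, fun C => mono ?_ (h2 C)⟩, fun _ => ⟨fun C _ => ?_, Q,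
      fun C _ => mono ?_ (h4 C)⟩⟩
    · rw [e]; exact (h1 C).trans (Nat.le_add_right _ _)
    · rw [e]; exact Nat.le_add_right _ _
    · rw [e]; exact (h3 C).trans (Nat.le_add_left _ _)
    · rw [e]; exact Nat.le_add_left _ _
  · exact ⟨π, h1, ⟨P, h2⟩, fun h' => absurd h' h⟩
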